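/- Let $H$ be a complex Hilbert space and let $A$ be an \emph{algebra of operators} on $H$, i.e. any (not necessarily closed or self-adjoint) subalgebra of $B(H)$ containing the identity operator. Equip the algebraic tensor product $A\otimes A$ (over $\mathbb{C}$) with one of the following norms: \begin{itemize} \item the Haagerup norm $\|w\|_h=\inf\bigl\|\sum_i a_ia_i^*\bigr\|^{1/2}\bigl\|\sum_i b_i^*b_i\bigr\|^{1/2}$, the infimum being over all finite representations $w=\sum_i a_i\otimes b_i$ with $a_i,b_i\in A$; \item the projective norm $\|w\|_\gamma=\inf\sum_i\|a_i\|\,\|b_i\|$, over the same representations; \item the operator space projective norm $\|w\|_\wedge=\inf\|\alpha\|\,\|x\|\,\|y\|\,\|\beta\|$, the infimum being over all representations $w=\alpha(x\otimes y)\beta=\sum_{i,j,k,l}\alpha_{(i,k)}\beta_{(j,l)}\,x_{ij}\otimes y_{kl}$ with $x\in M_m(A)\subseteq B(H^m)$, $y\in M_n(A)\subseteq B(H^n)$ and scalar row and column matrices $\alpha\in M_{1,mn}$, $\beta\in M_{mn,1}$. \end{itemize} The corresponding completion of $A\otimes A$ is the Haagerup, projective, respectively operator space projective, tensor product of $A$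 with itself. The product map $a\otimes b\mapsto ab$ and the actions $x\cdot(a\otimes b)=(xa)\otimes b$, $(a\otimes b)\cdot x=a\otimes(bx)$ $(x\in A)$ extend continuously to it (the product map with values in $B(H)$), and an element $u$ of it is called a \emph{diagonal} if its image under the product map is $1$ and $x\cdot u=u\cdot x$ for every $x\in A$. If there is a diagonal in at least one of these three tensor products of $A$ with itself, then $A$ is isomorphic, as a complex algebra, to a finite direct sum $\mathbb{M}_{n_1}\oplus\dots\oplus\mathbb{M}_{n_k}$ of full complex matrix algebras, with $k\ge 0$ and all $n_i\ge 1$. -/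

import Mathlib

open scoped TensorProduct

noncomputable section

namespace OperatorAlgebra

/-! ### Infimum seminorms -/

section Costs

/-- The seminorm `w ↦ inf (C w)`, where `C w` is the set of costs of all the representations
of `w`. -/
def infSeminorm {E : Type*} [AddCommGroup E] [Module ℂ E] (C : E → Set ℝ) (hne : ∀ w, (C w).Nonempty) (hpos : ∀ w, ∀ r ∈ C w, 0 ≤ r)
    (hzero : 0 ∈ C 0) (hsmul : ∀ (c : ℂ) w, ∀ r ∈ C w, ‖c‖ * r ∈ C (c • w))
    (hadd : ∀ v w, ∀ r ∈ C v, ∀ s ∈ C w, ∀ r' s', r < r' → s < s' →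
      ∃ t ∈ C (v + w), t ≤ r' + s') : Seminorm ℂ E :=
  Seminorm.ofSMulLE (fun w => sInf (C w))
    (le_antisymm (csInf_le ⟨0, fun r hr => hpos _ r hr⟩ hzero)
      (Real.sInf_nonneg fun r hr => hpos _ r hr))
    (by
      intro v w
      refine le_of_forall_pos_le_add fun ε hε => ?_
      obtain ⟨r, hr, hr'⟩ := exists_lt_of_csInf_lt (hne v)
        (lt_add_of_pos_right (sInf (C v)) (half_pos hε))
      obtain ⟨s, hs, hs'⟩ := exists_lt_of_csInf_lt (hne w)
        (lt_add_of_pos_right (sInf (C w)) (half_pos hε))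
      obtain ⟨t, ht, hle⟩ := hadd v w r hr s hs _ _ hr' hs'
      have := csInf_le (s := C (v + w)) ⟨0, fun r hr => hpos _ r hr⟩ ht
      linarith)
    (by
      intro c w
      refine le_of_forall_pos_le_add fun ε hε => ?_
      have hc : 0 < ‖c‖ + 1 := by positivity
      obtain ⟨r, hr, hr'⟩ := exists_lt_of_csInf_lt (hne w)
        (lt_add_of_pos_right (sInf (C w)) (div_pos hε hc))
      have h1 := csInf_le (s := C (c • w)) ⟨0, fun r hr => hpos _ r hr⟩ (hsmul c w r hr)
      have h2 : ‖c‖ * r ≤ ‖c‖ * (sInf (C w) + ε / (‖c‖ + 1)) :=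
        mul_le_mul_of_nonneg_left hr'.le (norm_nonneg c)
      have h3 : ‖c‖ * (ε / (‖c‖ + 1)) ≤ ε := by
        rw [mul_div_assoc', div_le_iff₀ hc]
        nlinarith [norm_nonneg c]
      linarith [mul_add ‖c‖ (sInf (C w)) (ε / (‖c‖ + 1))])

theorem sInf_le_of_costs {E : Type*} {C : E → Set ℝ} (hne : ∀ w, (C w).Nonempty)
    (hpos : ∀ w, ∀ r ∈ C w, 0 ≤ r) {v w : E} {k : ℝ} (hk : 0 ≤ k)
    (h : ∀ r ∈ C w, ∃ t ∈ C v, t ≤ k * r) : sInf (C v) ≤ k * sInf (C w) := by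
  have h0 : ∀ r ∈ C w, sInf (C v) ≤ k * r := fun r hr => by
    obtain ⟨t, ht, hle⟩ := h r hr
    exact (csInf_le ⟨0, fun r hr => hpos _ r hr⟩ ht).trans hle
  refine le_of_forall_pos_le_add fun ε hε => ?_
  have hc : 0 < k + 1 := by positivity
  obtain ⟨r, hr, hr'⟩ := exists_lt_of_csInf_lt (hne w)
    (lt_add_of_pos_right (sInf (C w)) (div_pos hε hc))
  have h2 : k * r ≤ k * (sInf (C w) + ε / (k + 1)) := mul_le_mul_of_nonneg_left hr'.le hk
  have h3 : k * (ε / (k + 1)) ≤ ε := by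
    rw [mul_div_assoc', div_le_iff₀ hc]
    nlinarith
  linarith [mul_add k (sInf (C w)) (ε / (k + 1)), h0 r hr]

theorem exists_pos_scale {x y s : ℝ} (hx : 0 ≤ x) (hy : 0 ≤ y) (h : x * y < s) :
    ∃ x', 0 < x' ∧ x ≤ x' ∧ x' * y < s := by
  have hs : 0 < s := (mul_nonneg hx hy).trans_lt h
  rcases hx.eq_or_lt with rfl | hx'
  · refine ⟨s / (y + 1), by positivity, by positivity, ?_⟩
    rw [div_mul_eq_mul_div, div_lt_iff₀ (by positivity)]
    nlinarith
  · exact ⟨x, hx', le_rfl, h⟩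

end Costs

variable {H : Type*} [NormedAddCommGroup H] [InnerProductSpace ℂ H]

section General

variable (A : Subalgebra ℂ (H →L[ℂ] H))

instance instAddCommGroupTensor : AddCommGroup (A ⊗[ℂ] A) := TensorProduct.addCommGroup

/-- The left action of `A` on `A ⊗ A`: `x · (a ⊗ b) = (x a) ⊗ b`. -/
def leftAct (x : A) : A ⊗[ℂ] A →ₗ[ℂ] A ⊗[ℂ] A :=
  LinearMap.rTensor A (LinearMap.mulLeft ℂ x)

/-- The right action of `A` on `A ⊗ A`: `(a ⊗ b) · x = a ⊗ (b x)`. -/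
def rightAct (x : A) : A ⊗[ℂ] A →ₗ[ℂ] A ⊗[ℂ] A :=
  LinearMap.lTensor A (LinearMap.mulRight ℂ x)

/-- The product map `a ⊗ b ↦ a b`, with values in `B(H)`. -/
def prodMap : A ⊗[ℂ] A →ₗ[ℂ] (H →L[ℂ] H) :=
  A.val.toLinearMap ∘ₗ LinearMap.mul' ℂ A

@[simp] theorem leftAct_tmul (x a b : A) : leftAct A x (a ⊗ₜ b) = (x * a) ⊗ₜ b := rfl

@[simp] theorem rightAct_tmul (x a b : A) : rightAct A x (a ⊗ₜ b) = a ⊗ₜ (b * x) := rfl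

@[simp] theorem prodMap_tmul (a b : A) : prodMap A (a ⊗ₜ b) = (a : H →L[ℂ] H) * b := rfl

/-- A seminorm on `A ⊗ A` for which the two actions of `A` and the product map are bounded, so
that they extend to the completion. -/
structure TensorSeminorm where
  toSeminorm : Seminorm ℂ (A ⊗[ℂ] A)
  leftAct_le : ∀ x w, toSeminorm (leftAct A x w) ≤ ‖x‖ * toSeminorm w
  rightAct_le : ∀ x w, toSeminorm (rightAct A x w) ≤ ‖x‖ * toSeminorm w
  prodMap_le : ∀ w, ‖prodMap A w‖ ≤ toSeminorm w

variable {A}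

namespace TensorSeminorm

variable (p : TensorSeminorm A)

/-- The algebraic tensor product `A ⊗ A`, equipped with the seminorm `p`. -/
@[nolint unusedArguments]
def Algebraic (_p : TensorSeminorm A) : Type _ := A ⊗[ℂ] A

instance : SeminormedAddCommGroup p.Algebraic :=
  AddGroupSeminorm.toSeminormedAddCommGroup (E := A ⊗[ℂ] A) p.toSeminorm.toAddGroupSeminorm

instance : NormedSpace ℂ p.Algebraic where
  toModule := (inferInstance : Module ℂ (A ⊗[ℂ] A))
  norm_smul_le c w := (map_smul_eq_mul p.toSeminorm c w).le

/-- The identity map from `A ⊗ A` to the same space equipped with the seminorm `p`. -/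
def of : A ⊗[ℂ] A ≃ₗ[ℂ] p.Algebraic where
  toFun w := w
  invFun w := w
  map_add' _ _ := rfl
  map_smul' _ _ := rfl
  left_inv _ := rfl
  right_inv _ := rfl

theorem norm_of (w : A ⊗[ℂ] A) : ‖p.of w‖ = p.toSeminorm w := rfl

/-- The (Hausdorff) completion of `A ⊗ A` with respect to `p`. -/
abbrev Completed : Type _ := UniformSpace.Completion p.Algebraic

/-- The continuous extension of the left action to the completion. -/
def leftActC (x : A) : p.Completed →L[ℂ] p.Completed :=
  ((p.of.toLinearMap ∘ₗ leftAct A x ∘ₗ p.of.symm.toLinearMap).mkContinuous ‖x‖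
    fun w => p.leftAct_le x (p.of.symm w)).completion

/-- The continuous extension of the right action to the completion. -/
def rightActC (x : A) : p.Completed →L[ℂ] p.Completed :=
  ((p.of.toLinearMap ∘ₗ rightAct A x ∘ₗ p.of.symm.toLinearMap).mkContinuous ‖x‖
    fun w => p.rightAct_le x (p.of.symm w)).completion

/-- The continuous extension of the product map to the completion. -/
def prodMapC [CompleteSpace H] : p.Completed →L[ℂ] (H →L[ℂ] H) :=
  ((prodMap A ∘ₗ p.of.symm.toLinearMap).mkContinuous 1
    fun w => (p.prodMap_le (p.of.symm w)).trans_eq (one_mul _).symm).fromCompletion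

theorem leftActC_coe (x : A) (w : A ⊗[ℂ] A) :
    p.leftActC x (p.of w : p.Completed) = (p.of (leftAct A x w) : p.Completed) :=
  ContinuousLinearMap.completion_apply_coe _ _

theorem rightActC_coe (x : A) (w : A ⊗[ℂ] A) :
    p.rightActC x (p.of w : p.Completed) = (p.of (rightAct A x w) : p.Completed) :=
  ContinuousLinearMap.completion_apply_coe _ _

theorem prodMapC_coe [CompleteSpace H] (w : A ⊗[ℂ] A) :
    p.prodMapC (p.of w : p.Completed) = prodMap A w :=
  ContinuousLinearMap.fromCompletion_apply_coe _ _

/-- `u` is a diagonal in the completed tensor product: its product is `1`, and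
`x · u = u · x` for every `x ∈ A`. -/
def IsDiagonal [CompleteSpace H] (u : p.Completed) : Prop :=
  p.prodMapC u = 1 ∧ ∀ x : A, p.leftActC x u = p.rightActC x u

end TensorSeminorm

end General

/-! ### The projective tensor norm -/

section Projective

variable {A : Subalgebra ℂ (H →L[ℂ] H)}

/-- The numbers `∑ ‖a i‖ ‖b i‖` over all finite representations `w = ∑ a i ⊗ b i`. -/
def projectiveCosts (w : A ⊗[ℂ] A) : Set ℝ :=
  {r | ∃ (ι : Type) (_ : Fintype ι) (a b : ι → A),
    w = ∑ i, a i ⊗ₜ[ℂ] b i ∧ r = ∑ i, ‖a i‖ * ‖b i‖}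

theorem exists_rep (w : A ⊗[ℂ] A) :
    ∃ (ι : Type) (_ : Fintype ι) (a b : ι → A), w = ∑ i, a i ⊗ₜ[ℂ] b i := by
  induction w using TensorProduct.induction_on with
  | zero => exact ⟨Empty, inferInstance, Empty.elim, Empty.elim, by simp⟩
  | tmul x y => exact ⟨Unit, inferInstance, fun _ => x, fun _ => y, by simp⟩
  | add v w hv hw =>
    obtain ⟨ι, _, a, b, rfl⟩ := hv
    obtain ⟨κ, _, c, d, rfl⟩ := hw
    exact ⟨ι ⊕ κ, inferInstance, Sum.elim a c, Sum.elim b d, by simp⟩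

theorem projectiveCosts_nonempty (w : A ⊗[ℂ] A) : (projectiveCosts w).Nonempty := by
  obtain ⟨ι, _, a, b, h⟩ := exists_rep w
  exact ⟨_, ι, _, a, b, h, rfl⟩

theorem projectiveCosts_nonneg (w : A ⊗[ℂ] A) : ∀ r ∈ projectiveCosts w, 0 ≤ r := by
  rintro r ⟨ι, _, a, b, -, rfl⟩
  positivity

variable (A) in
/-- The projective tensor norm on `A ⊗ A`. -/
def projectiveSeminorm : Seminorm ℂ (A ⊗[ℂ] A) :=
  infSeminorm projectiveCosts projectiveCosts_nonempty projectiveCosts_nonneg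
    ⟨Empty, inferInstance, Empty.elim, Empty.elim, by simp, by simp⟩
    (by
      rintro c w r ⟨ι, _, a, b, rfl, rfl⟩
      refine ⟨ι, inferInstance, fun i => c • a i, b, ?_, ?_⟩
      · simp [Finset.smul_sum, TensorProduct.smul_tmul']
      · rw [Finset.mul_sum]
        refine Finset.sum_congr rfl fun i _ => ?_
        rw [← mul_assoc]
        exact congrArg (· * ‖b i‖) (norm_smul c (a i : H →L[ℂ] H)).symm)
    (by
      rintro v w r ⟨ι, _, a, b, rfl, rfl⟩ s ⟨κ, _, c, d, rfl, rfl⟩ r' s' hr hs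
      refine ⟨_, ⟨ι ⊕ κ, inferInstance, Sum.elim a c, Sum.elim b d, by simp, rfl⟩, ?_⟩
      simp only [Fintype.sum_sum_type, Sum.elim_inl, Sum.elim_inr]
      linarith)

variable (A) in
/-- The projective tensor norm; its completion is the projective tensor product. -/
def projective : TensorSeminorm A where
  toSeminorm := projectiveSeminorm A
  leftAct_le x w := by
    refine sInf_le_of_costs projectiveCosts_nonempty projectiveCosts_nonneg (norm_nonneg x) ?_
    rintro r ⟨ι, _, a, b, rfl, rfl⟩
    refine ⟨_, ⟨ι, inferInstance, fun i => x * a i, b, by simp, rfl⟩, ?_⟩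
    rw [Finset.mul_sum]
    refine Finset.sum_le_sum fun i _ => ?_
    rw [← mul_assoc]
    exact mul_le_mul_of_nonneg_right (norm_mul_le _ _) (norm_nonneg _)
  rightAct_le x w := by
    refine sInf_le_of_costs projectiveCosts_nonempty projectiveCosts_nonneg (norm_nonneg x) ?_
    rintro r ⟨ι, _, a, b, rfl, rfl⟩
    refine ⟨_, ⟨ι, inferInstance, a, fun i => b i * x, by simp, rfl⟩, ?_⟩
    rw [Finset.mul_sum]
    refine Finset.sum_le_sum fun i _ => ?_
    rw [mul_left_comm]
    refine mul_le_mul_of_nonneg_left ?_ (norm_nonneg _)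
    rw [mul_comm ‖x‖]
    exact norm_mul_le _ _
  prodMap_le w := by
    refine le_csInf (projectiveCosts_nonempty w) ?_
    rintro r ⟨ι, _, a, b, rfl, rfl⟩
    rw [map_sum]
    exact norm_sum_le_of_le _ fun i _ => norm_mul_le _ _

end Projective

/-! ### The Haagerup tensor norm -/

section Haagerup

variable [CompleteSpace H] {A : Subalgebra ℂ (H →L[ℂ] H)}

/-- `‖∑ a i (a i)*‖ ^ (1/2)`. -/
def rowNorm {ι : Type} [Fintype ι] (a : ι → A) : ℝ :=
  √‖∑ i, (a i : H →L[ℂ] H) * star (a i : H →L[ℂ] H)‖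

/-- `‖∑ (b i)* (b i)‖ ^ (1/2)`. -/
def colNorm {ι : Type} [Fintype ι] (b : ι → A) : ℝ :=
  √‖∑ i, star (b i : H →L[ℂ] H) * (b i : H →L[ℂ] H)‖

/-- The numbers `‖∑ a i (a i)*‖ ^ (1/2) * ‖∑ (b i)* (b i)‖ ^ (1/2)` over all finite
representations `w = ∑ a i ⊗ b i`. -/
def haagerupCosts (w : A ⊗[ℂ] A) : Set ℝ :=
  {r | ∃ (ι : Type) (_ : Fintype ι) (a b : ι → A),
    w = ∑ i, a i ⊗ₜ[ℂ] b i ∧ r = rowNorm a * colNorm b}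

theorem rowNorm_nonneg {ι : Type} [Fintype ι] (a : ι → A) : 0 ≤ rowNorm a := Real.sqrt_nonneg _

theorem colNorm_nonneg {ι : Type} [Fintype ι] (a : ι → A) : 0 ≤ colNorm a := Real.sqrt_nonneg _

theorem sq_rowNorm {ι : Type} [Fintype ι] (a : ι → A) :
    rowNorm a ^ 2 = ‖∑ i, (a i : H →L[ℂ] H) * star (a i : H →L[ℂ] H)‖ :=
  Real.sq_sqrt (norm_nonneg _)

theorem sq_colNorm {ι : Type} [Fintype ι] (a : ι → A) :
    colNorm a ^ 2 = ‖∑ i, star (a i : H →L[ℂ] H) * (a i : H →L[ℂ] H)‖ :=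
  Real.sq_sqrt (norm_nonneg _)

theorem rowNorm_mul_le {ι : Type} [Fintype ι] (x : A) (a : ι → A) :
    rowNorm (fun i => x * a i) ≤ ‖x‖ * rowNorm a := by
  refine le_of_sq_le_sq ?_ (mul_nonneg (norm_nonneg _) (rowNorm_nonneg a))
  rw [mul_pow, sq_rowNorm, sq_rowNorm]
  have : ∑ i, ((x * a i : A) : H →L[ℂ] H) * star ((x * a i : A) : H →L[ℂ] H) =
      (x : H →L[ℂ] H) * (∑ i, (a i : H →L[ℂ] H) * star (a i : H →L[ℂ] H)) *
        star (x : H →L[ℂ] H) := by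
    simp [Finset.mul_sum, Finset.sum_mul, mul_assoc]
  rw [this]
  refine (norm_mul_le _ _).trans ((mul_le_mul_of_nonneg_right (norm_mul_le _ _)
    (norm_nonneg _)).trans_eq ?_)
  rw [norm_star]
  change ‖x‖ * _ * ‖x‖ = _
  ring

theorem colNorm_mul_le {ι : Type} [Fintype ι] (x : A) (b : ι → A) :
    colNorm (fun i => b i * x) ≤ ‖x‖ * colNorm b := by
  refine le_of_sq_le_sq ?_ (mul_nonneg (norm_nonneg _) (colNorm_nonneg b))
  rw [mul_pow, sq_colNorm, sq_colNorm]
  have : ∑ i, star ((b i * x : A) : H →L[ℂ] H) * ((b i * x : A) : H →L[ℂ] H) =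
      star (x : H →L[ℂ] H) * (∑ i, star (b i : H →L[ℂ] H) * (b i : H →L[ℂ] H)) *
        (x : H →L[ℂ] H) := by
    simp [Finset.mul_sum, Finset.sum_mul, mul_assoc]
  rw [this]
  refine (norm_mul_le _ _).trans ((mul_le_mul_of_nonneg_right (norm_mul_le _ _)
    (norm_nonneg _)).trans_eq ?_)
  rw [norm_star]
  change ‖x‖ * _ * ‖x‖ = _
  ring

theorem rowNorm_smul {ι : Type} [Fintype ι] (c : ℂ) (a : ι → A) :
    rowNorm (fun i => c • a i) = ‖c‖ * rowNorm a := by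
  have : ∑ i, ((c • a i : A) : H →L[ℂ] H) * star ((c • a i : A) : H →L[ℂ] H) =
      (c * star c) • ∑ i, (a i : H →L[ℂ] H) * star (a i : H →L[ℂ] H) := by
    simp [Finset.smul_sum, smul_smul, mul_comm]
  rw [rowNorm, this, norm_smul, rowNorm, Real.sqrt_mul (norm_nonneg _)]
  simp [Real.sqrt_mul_self]

theorem colNorm_smul {ι : Type} [Fintype ι] (c : ℂ) (a : ι → A) :
    colNorm (fun i => c • a i) = ‖c‖ * colNorm a := by
  have : ∑ i, star ((c • a i : A) : H →L[ℂ] H) * ((c • a i : A) : H →L[ℂ] H) =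
      (c * star c) • ∑ i, star (a i : H →L[ℂ] H) * (a i : H →L[ℂ] H) := by
    simp [Finset.smul_sum, smul_smul]
  rw [colNorm, this, norm_smul, colNorm, Real.sqrt_mul (norm_nonneg _)]
  simp [Real.sqrt_mul_self]

theorem haagerupCosts_nonempty (w : A ⊗[ℂ] A) : (haagerupCosts w).Nonempty := by
  obtain ⟨ι, _, a, b, h⟩ := exists_rep w
  exact ⟨_, ι, _, a, b, h, rfl⟩

theorem haagerupCosts_nonneg (w : A ⊗[ℂ] A) : ∀ r ∈ haagerupCosts w, 0 ≤ r := by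
  rintro r ⟨ι, _, a, b, -, rfl⟩
  exact mul_nonneg (rowNorm_nonneg a) (colNorm_nonneg b)

theorem haagerup_normalise {w : A ⊗[ℂ] A} {r s : ℝ} (hr : r ∈ haagerupCosts w) (hrs : r < s) :
    ∃ (ι : Type) (_ : Fintype ι) (a b : ι → A), w = ∑ i, a i ⊗ₜ[ℂ] b i ∧
      rowNorm a ^ 2 ≤ s ∧ colNorm b ^ 2 ≤ s := by
  have hs : 0 < s := (haagerupCosts_nonneg w r hr).trans_lt hrs
  obtain ⟨ι, _, a, b, rfl, rfl⟩ := hr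
  obtain ⟨k, hk, hak, hkb⟩ := exists_pos_scale (rowNorm_nonneg a) (colNorm_nonneg b) hrs
  have hq : 0 < √s := Real.sqrt_pos.2 hs
  have ht : 0 < √s / k := div_pos hq hk
  have hsq : √s ^ 2 = s := Real.sq_sqrt hs.le
  refine ⟨ι, inferInstance, fun i => ((√s / k : ℝ) : ℂ) • a i, fun i => (((√s / k)⁻¹ : ℝ) : ℂ) • b i,
    ?_, ?_, ?_⟩
  · refine Finset.sum_congr rfl fun i _ => ?_
    rw [TensorProduct.smul_tmul_smul, ← Complex.ofReal_mul, mul_inv_cancel₀ ht.ne']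
    simp
  · rw [rowNorm_smul, Complex.norm_real, Real.norm_of_nonneg ht.le]
    have : √s / k * rowNorm a ≤ √s := by
      rw [div_mul_eq_mul_div, div_le_iff₀ hk]
      exact mul_le_mul_of_nonneg_left hak hq.le
    calc _ ≤ √s ^ 2 := pow_le_pow_left₀ (mul_nonneg ht.le (rowNorm_nonneg a)) this 2
      _ = s := hsq
  · rw [colNorm_smul, Complex.norm_real, Real.norm_of_nonneg (inv_nonneg.2 ht.le)]
    have : (√s / k)⁻¹ * colNorm b ≤ √s := by
      rw [inv_div, div_mul_eq_mul_div, div_le_iff₀ hq]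
      nlinarith
    calc _ ≤ √s ^ 2 := pow_le_pow_left₀
          (mul_nonneg (inv_nonneg.2 ht.le) (colNorm_nonneg b)) this 2
      _ = s := hsq

variable (A) in
/-- The Haagerup tensor norm on `A ⊗ A`. -/
def haagerupSeminorm : Seminorm ℂ (A ⊗[ℂ] A) :=
  infSeminorm haagerupCosts haagerupCosts_nonempty haagerupCosts_nonneg
    ⟨Empty, inferInstance, Empty.elim, Empty.elim, by simp, by simp [rowNorm]⟩
    (by
      rintro c w r ⟨ι, _, a, b, rfl, rfl⟩
      refine ⟨ι, inferInstance, fun i => c • a i, b, ?_, ?_⟩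
      · simp [Finset.smul_sum, TensorProduct.smul_tmul']
      · rw [rowNorm_smul, mul_assoc])
    (by
      intro v w r hr s hs r' s' hr' hs'
      obtain ⟨ι, _, a, b, rfl, ha, hb⟩ := haagerup_normalise hr hr'
      obtain ⟨κ, _, c, d, rfl, hc, hd⟩ := haagerup_normalise hs hs'
      refine ⟨_, ⟨ι ⊕ κ, inferInstance, Sum.elim a c, Sum.elim b d, by simp, rfl⟩, ?_⟩
      have h1 : rowNorm (Sum.elim a c) ^ 2 ≤ r' + s' := by
        rw [sq_rowNorm] at *
        simp only [Fintype.sum_sum_type, Sum.elim_inl, Sum.elim_inr]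
        exact (norm_add_le _ _).trans (add_le_add ha hc)
      have h2 : colNorm (Sum.elim b d) ^ 2 ≤ r' + s' := by
        rw [sq_colNorm] at *
        simp only [Fintype.sum_sum_type, Sum.elim_inl, Sum.elim_inr]
        exact (norm_add_le _ _).trans (add_le_add hb hd)
      nlinarith [sq_nonneg (rowNorm (Sum.elim a c) - colNorm (Sum.elim b d))])

theorem norm_sum_apply_le_rowNorm {ι : Type} [Fintype ι] (a : ι → A) (z : ι → H) :
    ‖∑ i, (a i : H →L[ℂ] H) (z i)‖ ≤ rowNorm a * √(∑ i, ‖z i‖ ^ 2) := by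
  set v := ∑ i, (a i : H →L[ℂ] H) (z i) with hv
  have h1 : ∑ i, ‖star (a i : H →L[ℂ] H) v‖ ^ 2 ≤ (rowNorm a * ‖v‖) ^ 2 := by
    have h : ((∑ i, ‖star (a i : H →L[ℂ] H) v‖ ^ 2 : ℝ) : ℂ) =
        inner ℂ v ((∑ i, (a i : H →L[ℂ] H) * star (a i : H →L[ℂ] H)) v) := by
      simp only [sum_apply, inner_sum, Complex.ofReal_sum]
      refine Finset.sum_congr rfl fun i _ => ?_
      rw [mul_apply_eq_comp, ← ContinuousLinearMap.adjoint_inner_left,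
        ← ContinuousLinearMap.star_eq_adjoint, inner_self_eq_norm_sq_to_K]
      simp
    have h' : ∑ i, ‖star (a i : H →L[ℂ] H) v‖ ^ 2 =
        ‖inner ℂ v ((∑ i, (a i : H →L[ℂ] H) * star (a i : H →L[ℂ] H)) v)‖ := by
      rw [← h, Complex.norm_real, Real.norm_of_nonneg (by positivity)]
    rw [h', mul_pow, sq_rowNorm]
    refine (norm_inner_le_norm _ _).trans ?_
    have := ContinuousLinearMap.le_opNorm
      (∑ i, (a i : H →L[ℂ] H) * star (a i : H →L[ℂ] H)) v
    nlinarith [norm_nonneg v]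
  have h2 : ‖v‖ ^ 2 ≤ ∑ i, ‖star (a i : H →L[ℂ] H) v‖ * ‖z i‖ := by
    have h : ‖v‖ ^ 2 = ‖inner ℂ v v‖ := by
      rw [inner_self_eq_norm_sq_to_K]; simp
    rw [h]
    nth_rewrite 2 [hv]
    rw [inner_sum]
    refine norm_sum_le_of_le _ fun i _ => ?_
    rw [← ContinuousLinearMap.adjoint_inner_left, ← ContinuousLinearMap.star_eq_adjoint]
    exact norm_inner_le_norm _ _
  have h3 := Real.sum_mul_le_sqrt_mul_sqrt Finset.univ
    (fun i => ‖star (a i : H →L[ℂ] H) v‖) (fun i => ‖z i‖)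
  have h4 : √(∑ i, ‖star (a i : H →L[ℂ] H) v‖ ^ 2) ≤ rowNorm a * ‖v‖ :=
    Real.sqrt_le_iff.2 ⟨mul_nonneg (rowNorm_nonneg a) (norm_nonneg v), h1⟩
  have h5 : ‖v‖ * ‖v‖ ≤ (rowNorm a * √(∑ i, ‖z i‖ ^ 2)) * ‖v‖ := by
    have := mul_le_mul_of_nonneg_right h4 (Real.sqrt_nonneg (∑ i, ‖z i‖ ^ 2))
    nlinarith
  rcases (norm_nonneg v).eq_or_lt with h0 | h0
  · rw [← h0]; exact mul_nonneg (rowNorm_nonneg a) (Real.sqrt_nonneg _)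
  · exact le_of_mul_le_mul_right h5 h0

theorem sqrt_sum_apply_le_colNorm {ι : Type} [Fintype ι] (b : ι → A) (v : H) :
    √(∑ i, ‖(b i : H →L[ℂ] H) v‖ ^ 2) ≤ colNorm b * ‖v‖ := by
  refine Real.sqrt_le_iff.2 ⟨mul_nonneg (colNorm_nonneg b) (norm_nonneg v), ?_⟩
  have h : ((∑ i, ‖(b i : H →L[ℂ] H) v‖ ^ 2 : ℝ) : ℂ) =
      inner ℂ v ((∑ i, star (b i : H →L[ℂ] H) * (b i : H →L[ℂ] H)) v) := by
    simp only [sum_apply, inner_sum, Complex.ofReal_sum]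
    refine Finset.sum_congr rfl fun i _ => ?_
    rw [mul_apply_eq_comp, ContinuousLinearMap.star_eq_adjoint,
      ContinuousLinearMap.adjoint_inner_right, inner_self_eq_norm_sq_to_K]
    simp
  have h' : ∑ i, ‖(b i : H →L[ℂ] H) v‖ ^ 2 =
      ‖inner ℂ v ((∑ i, star (b i : H →L[ℂ] H) * (b i : H →L[ℂ] H)) v)‖ := by
    rw [← h, Complex.norm_real, Real.norm_of_nonneg (by positivity)]
  rw [h', mul_pow, sq_colNorm]
  refine (norm_inner_le_norm _ _).trans ?_
  have := ContinuousLinearMap.le_opNorm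
    (∑ i, star (b i : H →L[ℂ] H) * (b i : H →L[ℂ] H)) v
  nlinarith [norm_nonneg v]

variable (A) in
/-- The Haagerup tensor norm; its completion is the Haagerup tensor product. -/
def haagerup : TensorSeminorm A where
  toSeminorm := haagerupSeminorm A
  leftAct_le x w := by
    refine sInf_le_of_costs haagerupCosts_nonempty haagerupCosts_nonneg (norm_nonneg x) ?_
    rintro r ⟨ι, _, a, b, rfl, rfl⟩
    refine ⟨_, ⟨ι, inferInstance, fun i => x * a i, b, by simp, rfl⟩, ?_⟩
    rw [← mul_assoc]
    exact mul_le_mul_of_nonneg_right (rowNorm_mul_le x a) (colNorm_nonneg b)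
  rightAct_le x w := by
    refine sInf_le_of_costs haagerupCosts_nonempty haagerupCosts_nonneg (norm_nonneg x) ?_
    rintro r ⟨ι, _, a, b, rfl, rfl⟩
    refine ⟨_, ⟨ι, inferInstance, a, fun i => b i * x, by simp, rfl⟩, ?_⟩
    rw [mul_left_comm]
    exact mul_le_mul_of_nonneg_left (colNorm_mul_le x b) (rowNorm_nonneg a)
  prodMap_le w := by
    refine le_csInf (haagerupCosts_nonempty w) ?_
    rintro r ⟨ι, _, a, b, rfl, rfl⟩
    refine ContinuousLinearMap.opNorm_le_bound _
      (mul_nonneg (rowNorm_nonneg a) (colNorm_nonneg b)) fun v => ?_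
    have h1 := norm_sum_apply_le_rowNorm a fun i => (b i : H →L[ℂ] H) v
    have h2 := mul_le_mul_of_nonneg_left (sqrt_sum_apply_le_colNorm b v) (rowNorm_nonneg a)
    rw [← mul_assoc] at h2
    simpa using h1.trans h2

end Haagerup

/-! ### The operator space projective tensor norm -/

section OperatorProjective

variable {A : Subalgebra ℂ (H →L[ℂ] H)}

/-- The operator on `Hⁿ` (the `ℓ²`-direct sum of `n` copies of `H`) given by a matrix over
`A ⊆ B(H)`. -/
def matrixOp {ι : Type} [Fintype ι] (x : Matrix ι ι A) :
    PiLp 2 (fun _ : ι => H) →L[ℂ] PiLp 2 (fun _ : ι => H) :=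
  (PiLp.continuousLinearEquiv 2 ℂ (fun _ : ι => H)).symm.toContinuousLinearMap ∘L
    ContinuousLinearMap.pi fun i =>
      ∑ j, (x i j : H →L[ℂ] H) ∘L PiLp.proj (𝕜 := ℂ) 2 (fun _ : ι => H) j

/-- The numbers `‖α‖ ‖x‖ ‖y‖ ‖β‖` over all representations `w = α (x ⊗ y) β` with
`x ∈ M_m(A)`, `y ∈ M_n(A)`, a scalar row `α` and a scalar column `β` of length `m n`. The matrix
norms are those of `M_m(A) ⊆ B(Hᵐ)`; scalar rows and columns have their Euclidean norms. -/
def operatorProjectiveCosts (w : A ⊗[ℂ] A) : Set ℝ :=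
  {r | ∃ (ι κ : Type) (_ : Fintype ι) (_ : Fintype κ) (x : Matrix ι ι A) (y : Matrix κ κ A)
    (α β : EuclideanSpace ℂ (ι × κ)),
    w = ∑ s, ∑ t, (α s * β t) • (x s.1 t.1 ⊗ₜ[ℂ] y s.2 t.2) ∧
    r = ‖α‖ * ‖matrixOp x‖ * ‖matrixOp y‖ * ‖β‖}

@[simp] theorem matrixOp_apply {ι : Type} [Fintype ι] (x : Matrix ι ι A)
    (z : PiLp 2 (fun _ : ι => H)) (i : ι) :
    matrixOp x z i = ∑ j, (x i j : H →L[ℂ] H) (z j) := by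
  simp [matrixOp]

theorem norm_sq_matrixOp_apply {ι : Type} [Fintype ι] (x : Matrix ι ι A)
    (z : PiLp 2 (fun _ : ι => H)) :
    ‖matrixOp x z‖ ^ 2 = ∑ i, ‖∑ j, (x i j : H →L[ℂ] H) (z j)‖ ^ 2 := by
  simp [PiLp.norm_sq_eq_of_L2]

theorem norm_sq_matrixOp_apply_le {ι : Type} [Fintype ι] (x : Matrix ι ι A)
    (z : PiLp 2 (fun _ : ι => H)) :
    ‖matrixOp x z‖ ^ 2 ≤ ‖matrixOp x‖ ^ 2 * ∑ i, ‖z i‖ ^ 2 := by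
  rw [← PiLp.norm_sq_eq_of_L2, ← mul_pow]
  exact pow_le_pow_left₀ (norm_nonneg _) ((matrixOp x).le_opNorm z) 2

theorem norm_matrixOp_le {ι : Type} [Fintype ι] (x : Matrix ι ι A) {C : ℝ} (hC : 0 ≤ C)
    (h : ∀ z : PiLp 2 (fun _ : ι => H),
      ∑ i, ‖∑ j, (x i j : H →L[ℂ] H) (z j)‖ ^ 2 ≤ C ^ 2 * ‖z‖ ^ 2) : ‖matrixOp x‖ ≤ C := by
  refine ContinuousLinearMap.opNorm_le_bound _ hC fun z => ?_
  refine le_of_sq_le_sq ?_ (mul_nonneg hC (norm_nonneg _))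
  rw [norm_sq_matrixOp_apply, mul_pow]
  exact h z

theorem norm_matrixOp_smul_le {ι : Type} [Fintype ι] (c : ℂ) (x : Matrix ι ι A) :
    ‖matrixOp (c • x)‖ ≤ ‖c‖ * ‖matrixOp x‖ := by
  have h : matrixOp (c • x) = c • matrixOp x := by
    ext z i
    simp [Finset.smul_sum]
  rw [h]
  exact ContinuousLinearMap.opNorm_smul_le c (matrixOp x)

theorem norm_matrixOp_mul_left_le {ι : Type} [Fintype ι] (a : A) (x : Matrix ι ι A) :
    ‖matrixOp (Matrix.of fun i j => a * x i j)‖ ≤ ‖a‖ * ‖matrixOp x‖ := by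
  refine norm_matrixOp_le _ (by positivity) fun z => ?_
  have h : ∀ i, ‖∑ j, ((Matrix.of fun i j => a * x i j) i j : H →L[ℂ] H) (z j)‖ ^ 2 ≤
      ‖a‖ ^ 2 * ‖∑ j, (x i j : H →L[ℂ] H) (z j)‖ ^ 2 := fun i => by
    rw [← mul_pow]
    refine pow_le_pow_left₀ (norm_nonneg _) ?_ 2
    have := (a : H →L[ℂ] H).le_opNorm (∑ j, (x i j : H →L[ℂ] H) (z j))
    rw [map_sum] at this
    exact this
  refine (Finset.sum_le_sum fun i _ => h i).trans ?_
  rw [← Finset.mul_sum, ← norm_sq_matrixOp_apply, mul_pow, mul_assoc, ← mul_pow ‖matrixOp x‖]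
  exact mul_le_mul_of_nonneg_left
    (pow_le_pow_left₀ (norm_nonneg _) ((matrixOp x).le_opNorm z) 2) (by positivity)

theorem norm_matrixOp_mul_right_le {ι : Type} [Fintype ι] (a : A) (x : Matrix ι ι A) :
    ‖matrixOp (Matrix.of fun i j => x i j * a)‖ ≤ ‖a‖ * ‖matrixOp x‖ := by
  refine norm_matrixOp_le _ (by positivity) fun z => ?_
  have h := norm_sq_matrixOp_apply_le x
    (WithLp.toLp 2 fun j => (a : H →L[ℂ] H) (z j))
  rw [norm_sq_matrixOp_apply] at h
  have h2 : ∑ j, ‖(a : H →L[ℂ] H) (z j)‖ ^ 2 ≤ ‖a‖ ^ 2 * ‖z‖ ^ 2 := by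
    rw [PiLp.norm_sq_eq_of_L2, Finset.mul_sum]
    refine Finset.sum_le_sum fun j _ => ?_
    rw [← mul_pow]
    exact pow_le_pow_left₀ (norm_nonneg _) ((a : H →L[ℂ] H).le_opNorm _) 2
  have h3 := mul_le_mul_of_nonneg_left h2 (sq_nonneg ‖matrixOp x‖)
  have h4 := h.trans h3
  rw [mul_pow, mul_comm (‖a‖ ^ 2), mul_assoc]
  simpa using h4

theorem norm_matrixOp_fromBlocks_le {ι κ : Type} [Fintype ι] [Fintype κ] {x : Matrix ι ι A}
    {y : Matrix κ κ A} (hx : ‖matrixOp x‖ ≤ 1) (hy : ‖matrixOp y‖ ≤ 1) :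
    ‖matrixOp (Matrix.fromBlocks x 0 0 y)‖ ≤ 1 := by
  refine norm_matrixOp_le _ zero_le_one fun z => ?_
  have h1 := norm_sq_matrixOp_apply_le x (WithLp.toLp 2 fun j => z (Sum.inl j))
  have h2 := norm_sq_matrixOp_apply_le y (WithLp.toLp 2 fun j => z (Sum.inr j))
  rw [norm_sq_matrixOp_apply] at h1 h2
  have h3 : ‖matrixOp x‖ ^ 2 ≤ 1 := pow_le_one₀ (norm_nonneg (matrixOp x)) hx
  have h4 : ‖matrixOp y‖ ^ 2 ≤ 1 := pow_le_one₀ (norm_nonneg (matrixOp y)) hy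
  have h5 := h1.trans (mul_le_of_le_one_left (by positivity) h3)
  have h6 := h2.trans (mul_le_of_le_one_left (by positivity) h4)
  simp only [PiLp.norm_sq_eq_of_L2, Fintype.sum_sum_type, one_pow, one_mul]
  simpa using add_le_add h5 h6

theorem operatorProjectiveCosts_nonempty (w : A ⊗[ℂ] A) : (operatorProjectiveCosts w).Nonempty := by
  classical
  obtain ⟨ι, _, a, b, rfl⟩ := exists_rep w
  refine ⟨_, ι, ι, inferInstance, inferInstance, Matrix.of fun i _ => a i,
    Matrix.of fun i _ => b i, WithLp.toLp 2 fun s => if s.1 = s.2 then 1 else 0,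
    WithLp.toLp 2 fun _ => (Fintype.card (ι × ι) : ℂ)⁻¹, ?_, rfl⟩
  rcases isEmpty_or_nonempty ι with h | h
  · simp
  · have hc : (Fintype.card (ι × ι) : ℂ) ≠ 0 := Nat.cast_ne_zero.2 Fintype.card_ne_zero
    rw [Fintype.sum_prod_type]
    refine Finset.sum_congr rfl fun i _ => ?_
    rw [Finset.sum_eq_single i]
    · simp only [Matrix.of_apply, if_true, one_mul, Finset.sum_const, Finset.card_univ]
      rw [← Nat.cast_smul_eq_nsmul ℂ, smul_smul, mul_inv_cancel₀ hc, one_smul]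
    · intro k _ hk
      simp [hk.symm]
    · simp

theorem operatorProjectiveCosts_nonneg (w : A ⊗[ℂ] A) :
    ∀ r ∈ operatorProjectiveCosts w, 0 ≤ r := by
  rintro r ⟨ι, κ, _, _, x, y, α, β, -, rfl⟩
  positivity

theorem operatorProjective_normalise {w : A ⊗[ℂ] A} {r u : ℝ}
    (hr : r ∈ operatorProjectiveCosts w) (hru : r < u) :
    ∃ (ι κ : Type) (_ : Fintype ι) (_ : Fintype κ) (x : Matrix ι ι A) (y : Matrix κ κ A)
      (α β : EuclideanSpace ℂ (ι × κ)),
      w = ∑ s, ∑ t, (α s * β t) • (x s.1 t.1 ⊗ₜ[ℂ] y s.2 t.2) ∧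
      ‖matrixOp x‖ ≤ 1 ∧ ‖matrixOp y‖ ≤ 1 ∧ ‖α‖ ^ 2 ≤ u ∧ ‖β‖ ^ 2 ≤ u := by
  have hu : 0 < u := (operatorProjectiveCosts_nonneg w r hr).trans_lt hru
  obtain ⟨ι, κ, _, _, x, y, α, β, rfl, rfl⟩ := hr
  obtain ⟨X, hX, hxX, h1⟩ := exists_pos_scale (norm_nonneg (matrixOp x))
    (y := ‖α‖ * ‖matrixOp y‖ * ‖β‖) (s := u) (by positivity) (by linarith)
  obtain ⟨Y, hY, hyY, h2⟩ := exists_pos_scale (norm_nonneg (matrixOp y))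
    (y := ‖α‖ * X * ‖β‖) (s := u) (by positivity) (by linarith)
  obtain ⟨K, hK, haK, h3⟩ := exists_pos_scale (norm_nonneg α)
    (y := X * Y * ‖β‖) (s := u) (by positivity) (by linarith)
  have hq : 0 < √u := Real.sqrt_pos.2 hu
  have hsq : √u ^ 2 = u := Real.sq_sqrt hu.le
  have hn : ∀ t : ℝ, 0 < t → ‖(t : ℂ)‖ = t := fun t ht => by
    rw [Complex.norm_real, Real.norm_of_nonneg ht.le]
  refine ⟨ι, κ, inferInstance, inferInstance, ((X⁻¹ : ℝ) : ℂ) • x, ((Y⁻¹ : ℝ) : ℂ) • y,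
    ((√u / K : ℝ) : ℂ) • α, ((K * X * Y / √u : ℝ) : ℂ) • β, ?_, ?_, ?_, ?_, ?_⟩
  · refine Finset.sum_congr rfl fun s _ => Finset.sum_congr rfl fun t _ => ?_
    simp only [Matrix.smul_apply, PiLp.smul_apply, smul_eq_mul]
    rw [TensorProduct.smul_tmul_smul, smul_smul]
    congr 1
    have h : ((√u / K : ℝ) : ℂ) * ((K * X * Y / √u : ℝ) : ℂ) * (((X⁻¹ : ℝ) : ℂ) * ((Y⁻¹ : ℝ) : ℂ))
        = 1 := by
      rw [← Complex.ofReal_mul, ← Complex.ofReal_mul, ← Complex.ofReal_mul, ← Complex.ofReal_one]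
      congr 1
      field_simp
    linear_combination (-(α s * β t)) * h
  · refine (norm_matrixOp_smul_le _ x).trans ?_
    rw [hn _ (inv_pos.2 hX), inv_mul_le_iff₀ hX]
    simpa using hxX
  · refine (norm_matrixOp_smul_le _ y).trans ?_
    rw [hn _ (inv_pos.2 hY), inv_mul_le_iff₀ hY]
    simpa using hyY
  · rw [norm_smul, hn _ (div_pos hq hK)]
    have : √u / K * ‖α‖ ≤ √u := by
      rw [div_mul_eq_mul_div, div_le_iff₀ hK]
      exact mul_le_mul_of_nonneg_left haK hq.le
    calc _ ≤ √u ^ 2 := pow_le_pow_left₀ (by positivity) this 2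
      _ = u := hsq
  · rw [norm_smul, hn _ (by positivity)]
    have : K * X * Y / √u * ‖β‖ ≤ √u := by
      rw [div_mul_eq_mul_div, div_le_iff₀ hq]
      nlinarith
    calc _ ≤ √u ^ 2 := pow_le_pow_left₀ (by positivity) this 2
      _ = u := hsq

variable (A) in
/-- The operator space projective tensor norm on `A ⊗ A`. -/
def operatorProjectiveSeminorm : Seminorm ℂ (A ⊗[ℂ] A) :=
  infSeminorm operatorProjectiveCosts operatorProjectiveCosts_nonempty
    operatorProjectiveCosts_nonneg
    ⟨Empty, Empty, inferInstance, inferInstance, 0, 0, 0, 0, by simp, by simp⟩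
    (by
      rintro c w r ⟨ι, κ, _, _, x, y, α, β, rfl, rfl⟩
      refine ⟨ι, κ, inferInstance, inferInstance, x, y, c • α, β, ?_, ?_⟩
      · simp [Finset.smul_sum, smul_smul, mul_assoc]
      · rw [norm_smul, mul_assoc, mul_assoc, mul_assoc, mul_assoc, mul_assoc])
    (by
      intro v w r hr s hs r' s' hr' hs'
      obtain ⟨ι, κ, _, _, x, y, α, β, rfl, hx, hy, hα, hβ⟩ := operatorProjective_normalise hr hr'
      obtain ⟨ι', κ', _, _, x', y', α', β', rfl, hx', hy', hα', hβ'⟩ :=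
        operatorProjective_normalise hs hs'
      let join : EuclideanSpace ℂ (ι × κ) → EuclideanSpace ℂ (ι' × κ') →
          EuclideanSpace ℂ ((ι ⊕ ι') × (κ ⊕ κ')) := fun γ γ' => WithLp.toLp 2 fun s =>
        Sum.elim (fun i => Sum.elim (fun k => γ (i, k)) (fun _ => 0) s.2)
          (fun i => Sum.elim (fun _ => 0) (fun k => γ' (i, k)) s.2) s.1
      have hjoin : ∀ γ γ', ‖join γ γ'‖ ^ 2 = ‖γ‖ ^ 2 + ‖γ'‖ ^ 2 := fun γ γ' => by
        simp [join, EuclideanSpace.norm_sq_eq, Fintype.sum_prod_type]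
      refine ⟨_, ⟨ι ⊕ ι', κ ⊕ κ', inferInstance, inferInstance, Matrix.fromBlocks x 0 0 x',
        Matrix.fromBlocks y 0 0 y', join α α', join β β', ?_, rfl⟩, ?_⟩
      · simp [join, Fintype.sum_prod_type]
      · have h1 := norm_matrixOp_fromBlocks_le hx hx'
        have h2 := norm_matrixOp_fromBlocks_le hy hy'
        have h3 := hjoin α α'
        have h4 := hjoin β β'
        have h5 : ‖join α α'‖ * ‖matrixOp (Matrix.fromBlocks x 0 0 x')‖ *
            ‖matrixOp (Matrix.fromBlocks y 0 0 y')‖ * ‖join β β'‖ ≤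
            ‖join α α'‖ * 1 * 1 * ‖join β β'‖ := by gcongr
        nlinarith [sq_nonneg (‖join α α'‖ - ‖join β β'‖)])

theorem norm_prodMap_le_of_cost {w : A ⊗[ℂ] A} {r : ℝ} (hr : r ∈ operatorProjectiveCosts w) :
    ‖prodMap A w‖ ≤ r := by
  obtain ⟨ι, κ, _, _, x, y, α, β, rfl, rfl⟩ := hr
  refine ContinuousLinearMap.opNorm_le_bound _ (by positivity) fun v => ?_
  set ζ : κ → PiLp 2 (fun _ : ι => H) := fun k => WithLp.toLp 2 fun j =>
    matrixOp y (WithLp.toLp 2 fun l => β (j, l) • v) k with hζ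
  have h1 : prodMap A (∑ s, ∑ t, (α s * β t) • (x s.1 t.1 ⊗ₜ[ℂ] y s.2 t.2)) v =
      ∑ s, α s • matrixOp x (ζ s.2) s.1 := by
    simp only [map_sum, map_smul, prodMap_tmul, sum_apply]
    refine Finset.sum_congr rfl fun s _ => ?_
    simp [hζ, Finset.smul_sum, smul_smul, Fintype.sum_prod_type]
  have h2 : ∑ s : ι × κ, ‖matrixOp x (ζ s.2) s.1‖ ^ 2 ≤
      (‖matrixOp x‖ * ‖matrixOp y‖ * ‖β‖ * ‖v‖) ^ 2 := by
    calc ∑ s : ι × κ, ‖matrixOp x (ζ s.2) s.1‖ ^ 2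
        = ∑ k, ‖matrixOp x (ζ k)‖ ^ 2 := by
          simp only [PiLp.norm_sq_eq_of_L2, Fintype.sum_prod_type_right]
      _ ≤ ∑ k, ‖matrixOp x‖ ^ 2 * ∑ j, ‖ζ k j‖ ^ 2 :=
          Finset.sum_le_sum fun k _ => norm_sq_matrixOp_apply_le x (ζ k)
      _ = ‖matrixOp x‖ ^ 2 * ∑ j, ‖matrixOp y (WithLp.toLp 2 fun l => β (j, l) • v)‖ ^ 2 := by
          rw [← Finset.mul_sum, Finset.sum_comm]
          simp only [PiLp.norm_sq_eq_of_L2, hζ]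
      _ ≤ ‖matrixOp x‖ ^ 2 * ∑ j, ‖matrixOp y‖ ^ 2 * ∑ l, ‖β (j, l) • v‖ ^ 2 := by
          refine mul_le_mul_of_nonneg_left (Finset.sum_le_sum fun j _ => ?_) (sq_nonneg _)
          exact norm_sq_matrixOp_apply_le y (WithLp.toLp 2 fun l => β (j, l) • v)
      _ = (‖matrixOp x‖ * ‖matrixOp y‖ * ‖β‖ * ‖v‖) ^ 2 := by
          rw [mul_pow, mul_pow, mul_pow, EuclideanSpace.norm_sq_eq, Fintype.sum_prod_type]
          simp only [norm_smul, mul_pow, ← Finset.sum_mul, ← Finset.mul_sum]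
          ring
  rw [h1]
  calc ‖∑ s, α s • matrixOp x (ζ s.2) s.1‖
      ≤ ∑ s, ‖α s‖ * ‖matrixOp x (ζ s.2) s.1‖ :=
        norm_sum_le_of_le _ fun s _ => (norm_smul _ _).le
    _ ≤ √(∑ s, ‖α s‖ ^ 2) * √(∑ s : ι × κ, ‖matrixOp x (ζ s.2) s.1‖ ^ 2) :=
        Real.sum_mul_le_sqrt_mul_sqrt _ _ _
    _ ≤ ‖α‖ * (‖matrixOp x‖ * ‖matrixOp y‖ * ‖β‖ * ‖v‖) := by
        rw [← EuclideanSpace.norm_eq]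
        exact mul_le_mul_of_nonneg_left (Real.sqrt_le_iff.2 ⟨by positivity, h2⟩) (norm_nonneg _)
    _ = _ := by ring

variable (A) in
/-- The operator space projective tensor norm; its completion is the operator space projective
tensor product. -/
def operatorProjective : TensorSeminorm A where
  toSeminorm := operatorProjectiveSeminorm A
  leftAct_le a w := by
    refine sInf_le_of_costs operatorProjectiveCosts_nonempty operatorProjectiveCosts_nonneg
      (norm_nonneg a) ?_
    rintro r ⟨ι, κ, _, _, x, y, α, β, rfl, rfl⟩
    refine ⟨_, ⟨ι, κ, inferInstance, inferInstance, Matrix.of fun i j => a * x i j, y, α, β,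
      by simp, rfl⟩, ?_⟩
    calc _ ≤ ‖α‖ * (‖a‖ * ‖matrixOp x‖) * ‖matrixOp y‖ * ‖β‖ := by
          gcongr; exact norm_matrixOp_mul_left_le a x
      _ = _ := by ring
  rightAct_le a w := by
    refine sInf_le_of_costs operatorProjectiveCosts_nonempty operatorProjectiveCosts_nonneg
      (norm_nonneg a) ?_
    rintro r ⟨ι, κ, _, _, x, y, α, β, rfl, rfl⟩
    refine ⟨_, ⟨ι, κ, inferInstance, inferInstance, x, Matrix.of fun i j => y i j * a, α, β,
      by simp, rfl⟩, ?_⟩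
    calc _ ≤ ‖α‖ * ‖matrixOp x‖ * (‖a‖ * ‖matrixOp y‖) * ‖β‖ := by
          gcongr; exact norm_matrixOp_mul_right_le a y
      _ = _ := by ring
  prodMap_le w := le_csInf (operatorProjectiveCosts_nonempty w) fun _ => norm_prodMap_le_of_cost

end OperatorProjective

end OperatorAlgebra

end

/-! All three norms share one property, `SandwichBounded`: the maps `a ⊗ b ↦ a P b` are bounded by
`‖P‖`. Taking `P` of rank one bounds the slices `a ⊗ b ↦ ⟪η, a e⟫ b` as well. Everything after these
bounds uses only this property of the norm.

The core is that a diagonal `u` forces `A` to be finite dimensional. Fix an algebraic approximant `v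
= ∑ a i ⊗ b i` of `u` with `N` terms, then a second one, `w`, so close to `u` that `N` errors of its
size are still small. The slices of `w` along unit vectors stay in a bounded subset of a
finite-dimensional space, so finitely many of them form a net. Let `x ∈ A` satisfy the finitely many
linear equations that make the net slices of `x · w` vanish. As `x · w ≈ w · x`, every unit slice of
`w`, multiplied by `x` on the right, is small compared with `‖x‖`. For `ξ` in the range of `x`, `ξ`
is close to `∑ a i (b i ξ) = ∑ a i (P (b i ξ))`, where `P` projects onto the span of the `b i ξ` and
has rank at most `N`. Replacing `v` by `w` under this sandwich costs little, and splitting `P` into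
rank-one projections leaves at most `N` small slices. Hence `‖x‖ ≤ ‖x‖ / 2`, so `x = 0`, and
finitely many functionals separate the points of `A` (`SandwichBounded.norm_le_of_slice_eq_zero`,
`SandwichBounded.finiteDimensional`).

In finite dimensions the diagonal already lies in `A ⊗ A`
(`SandwichBounded.exists_algebraic_diagonal`). Averaging linear projections over it shows that `A`
is semisimple (`isSemisimpleRing_of_algebraic_diagonal`), and Wedderburn–Artin over `ℂ` concludes.
-/

noncomputable section

namespace OperatorAlgebra

variable {H : Type*} [NormedAddCommGroup H] [InnerProductSpace ℂ H]

/-! ### Sandwich maps and slice maps -/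

section Sandwich

variable (A : Subalgebra ℂ (H →L[ℂ] H))

/-- The linear map `a ⊗ b ↦ a P b`, for a fixed operator `P`. -/
def sandwich (P : H →L[ℂ] H) : A ⊗[ℂ] A →ₗ[ℂ] (H →L[ℂ] H) :=
  TensorProduct.lift (((LinearMap.mul ℂ (H →L[ℂ] H)).comp
    ((LinearMap.mulRight ℂ P).comp A.val.toLinearMap)).compl₂ A.val.toLinearMap)

/-- The slice map `a ⊗ b ↦ ⟪η, a e⟫ b`. -/
def slice (e η : H) : A ⊗[ℂ] A →ₗ[ℂ] (H →L[ℂ] H) :=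
  TensorProduct.lift ((LinearMap.lsmul ℂ (H →L[ℂ] H)).comp
    ((innerSL ℂ η).toLinearMap.comp ((ContinuousLinearMap.apply ℂ H e).toLinearMap.comp
      A.val.toLinearMap)) |>.compl₂ A.val.toLinearMap)

@[simp] theorem sandwich_tmul (P : H →L[ℂ] H) (a b : A) :
    sandwich A P (a ⊗ₜ b) = (a : H →L[ℂ] H) * P * b := rfl

@[simp] theorem slice_tmul (e η : H) (a b : A) :
    slice A e η (a ⊗ₜ b) = inner ℂ η ((a : H →L[ℂ] H) e) • (b : H →L[ℂ] H) := rfl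

theorem sandwich_sum {ι : Type*} (s : Finset ι) (P : ι → H →L[ℂ] H) (w : A ⊗[ℂ] A) :
    sandwich A (∑ i ∈ s, P i) w = ∑ i ∈ s, sandwich A (P i) w := by
  induction w using TensorProduct.induction_on with
  | zero => simp
  | tmul a b => simp [Finset.mul_sum, Finset.sum_mul]
  | add v w hv hw => simp [hv, hw, Finset.sum_add_distrib]

theorem slice_rightAct (e η : H) (x : A) (w : A ⊗[ℂ] A) :
    slice A e η (rightAct A x w) = slice A e η w * x := by
  induction w using TensorProduct.induction_on with
  | zero => simp
  | tmul a b => simp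
  | add v w hv hw => simp [hv, hw, add_mul]

/-- On `a ⊗ b` both sides equal `⟪η, a e⟫ ⟪ζ, b ξ⟫`. This dictionary between slices and rank-one
sandwiches transfers the norm bound to slices, and later turns a sandwiched finite-rank projection
into a sum of slices. -/
theorem inner_slice (e η ζ ξ : H) (w : A ⊗[ℂ] A) :
    inner ℂ ζ (slice A e η w ξ) =
      inner ℂ η (sandwich A (InnerProductSpace.rankOne ℂ e ζ) w ξ) := by
  induction w using TensorProduct.induction_on with
  | zero => simp
  | tmul a b => simp [mul_comm]
  | add v w hv hw => simp [hv, hw]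

variable {A}

/-- All sandwich maps `a ⊗ b ↦ a P b` are bounded by `‖P‖` for the seminorm `p`. -/
def SandwichBounded (p : TensorSeminorm A) : Prop :=
  ∀ (P : H →L[ℂ] H) (w : A ⊗[ℂ] A), ‖sandwich A P w‖ ≤ p.toSeminorm w * ‖P‖

theorem norm_le_of_norm_inner_le {v : H} {M : ℝ}
    (h : ∀ η : H, ‖η‖ ≤ 1 → ‖inner ℂ η v‖ ≤ M) : ‖v‖ ≤ M := by
  rcases eq_or_ne v 0 with rfl | hv
  · simpa using h 0 (by simp)
  · have hv' : ‖v‖ ≠ 0 := norm_ne_zero_iff.2 hv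
    have := h ((‖v‖⁻¹ : ℂ) • v) (by simp [norm_smul, hv'])
    rw [inner_smul_left, inner_self_eq_norm_sq_to_K] at this
    simpa [pow_two, hv'] using this

/-- Testing against a vector `ζ` of the unit ball gives a matrix coefficient of the sandwich by
`rankOne ℂ e ζ`, an operator of norm `‖e‖ ‖ζ‖`. -/
theorem SandwichBounded.norm_slice_le {p : TensorSeminorm A} (hp : SandwichBounded p) (e η : H)
    (w : A ⊗[ℂ] A) : ‖slice A e η w‖ ≤ p.toSeminorm w * ‖e‖ * ‖η‖ := by
  have h0 := apply_nonneg p.toSeminorm w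
  refine ContinuousLinearMap.opNorm_le_bound _ (by positivity) fun ξ => ?_
  refine norm_le_of_norm_inner_le fun ζ hζ => ?_
  rw [inner_slice]
  refine (norm_inner_le_norm _ _).trans ?_
  have h1 := (sandwich A (InnerProductSpace.rankOne ℂ e ζ) w).le_opNorm ξ
  have h2 := hp (InnerProductSpace.rankOne ℂ e ζ) w
  rw [InnerProductSpace.norm_rankOne] at h2
  calc _ ≤ ‖η‖ * ((p.toSeminorm w * (‖e‖ * 1)) * ‖ξ‖) := by
        gcongr
        exact h1.trans (mul_le_mul_of_nonneg_right (h2.trans (by gcongr)) (norm_nonneg _))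
    _ = _ := by ring

end Sandwich

/-! ### The three tensor norms bound the sandwich maps -/

section Bounds

variable {A : Subalgebra ℂ (H →L[ℂ] H)}

theorem le_sInf_mul {C : Set ℝ} (hne : C.Nonempty) {a k : ℝ} (hk : 0 ≤ k)
    (h : ∀ r ∈ C, a ≤ r * k) : a ≤ sInf C * k := by
  rcases hk.eq_or_lt with rfl | hk
  · obtain ⟨r, hr⟩ := hne
    simpa using h r hr
  · rw [← div_le_iff₀ hk]
    exact le_csInf hne fun r hr => (div_le_iff₀ hk).2 (h r hr)

theorem sandwichBounded_projective : SandwichBounded (projective A) := fun P w => by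
  refine le_sInf_mul (projectiveCosts_nonempty w) (norm_nonneg P) ?_
  rintro r ⟨ι, _, a, b, rfl, rfl⟩
  rw [map_sum, Finset.sum_mul]
  refine norm_sum_le_of_le _ fun i _ => ?_
  rw [sandwich_tmul, mul_right_comm]
  exact (norm_mul_le _ _).trans (mul_le_mul_of_nonneg_right (norm_mul_le _ _) (norm_nonneg _))

/-- The operator `∑ a i P b i` is the row `a` times `diag(P, …, P)` times the column `b`, and the
diagonal factor has norm at most `‖P‖`. -/
theorem sandwichBounded_haagerup [CompleteSpace H] : SandwichBounded (haagerup A) := fun P w => by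
  refine le_sInf_mul (haagerupCosts_nonempty w) (norm_nonneg P) ?_
  rintro r ⟨ι, _, a, b, rfl, rfl⟩
  refine ContinuousLinearMap.opNorm_le_bound _ (mul_nonneg (mul_nonneg (rowNorm_nonneg a)
    (colNorm_nonneg b)) (norm_nonneg P)) fun v => ?_
  have h1 := norm_sum_apply_le_rowNorm a fun i => P ((b i : H →L[ℂ] H) v)
  have h2 : √(∑ i, ‖P ((b i : H →L[ℂ] H) v)‖ ^ 2) ≤ ‖P‖ * (colNorm b * ‖v‖) := by
    refine le_trans ?_ (mul_le_mul_of_nonneg_left (sqrt_sum_apply_le_colNorm b v) (norm_nonneg P))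
    refine Real.sqrt_le_iff.2 ⟨by positivity, ?_⟩
    rw [mul_pow, Real.sq_sqrt (by positivity), Finset.mul_sum]
    refine Finset.sum_le_sum fun i _ => ?_
    rw [← mul_pow]
    exact pow_le_pow_left₀ (norm_nonneg _) (P.le_opNorm _) 2
  have h3 := mul_le_mul_of_nonneg_left h2 (rowNorm_nonneg a)
  have h4 : sandwich A P (∑ i, a i ⊗ₜ[ℂ] b i) v =
      ∑ i, (a i : H →L[ℂ] H) (P ((b i : H →L[ℂ] H) v)) := by
    simp [map_sum, sum_apply]
  rw [h4]
  exact (h1.trans h3).trans_eq (by ring)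

/-- The value at `v` factors as `α (x ⊗ 1) (P on every coordinate) (1 ⊗ y) β v`: `y` acts on the
`κ`-coordinate for each fixed `j`, then `x` acts on the `ι`-coordinate for each fixed `k`, and
Cauchy–Schwarz handles the row `α`. -/
theorem sandwichBounded_operatorProjective : SandwichBounded (operatorProjective A) :=
    fun P w => by
  refine le_sInf_mul (operatorProjectiveCosts_nonempty w) (norm_nonneg P) ?_
  rintro r ⟨ι, κ, _, _, x, y, α, β, rfl, rfl⟩
  refine ContinuousLinearMap.opNorm_le_bound _ (by positivity) fun v => ?_
  set η : ι → PiLp 2 (fun _ : κ => H) := fun j => matrixOp y (WithLp.toLp 2 fun l => β (j, l) • v)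
    with hη
  set ζ : κ → PiLp 2 (fun _ : ι => H) := fun k => WithLp.toLp 2 fun j => P (η j k) with hζ
  have h1 : sandwich A P (∑ s, ∑ t, (α s * β t) • (x s.1 t.1 ⊗ₜ[ℂ] y s.2 t.2)) v =
      ∑ s, α s • matrixOp x (ζ s.2) s.1 := by
    simp only [map_sum, map_smul, sandwich_tmul, sum_apply]
    refine Finset.sum_congr rfl fun s _ => ?_
    simp [hζ, hη, Finset.smul_sum, smul_smul, Fintype.sum_prod_type]
  have h2 : ∑ s : ι × κ, ‖matrixOp x (ζ s.2) s.1‖ ^ 2 ≤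
      (‖matrixOp x‖ * ‖matrixOp y‖ * ‖P‖ * ‖β‖ * ‖v‖) ^ 2 := by
    calc ∑ s : ι × κ, ‖matrixOp x (ζ s.2) s.1‖ ^ 2
        = ∑ k, ‖matrixOp x (ζ k)‖ ^ 2 := by
          simp only [PiLp.norm_sq_eq_of_L2, Fintype.sum_prod_type_right]
      _ ≤ ∑ k, ‖matrixOp x‖ ^ 2 * ∑ j, ‖ζ k j‖ ^ 2 :=
          Finset.sum_le_sum fun k _ => norm_sq_matrixOp_apply_le x (ζ k)
      _ ≤ ∑ k, ‖matrixOp x‖ ^ 2 * ∑ j, ‖P‖ ^ 2 * ‖η j k‖ ^ 2 := by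
          refine Finset.sum_le_sum fun k _ => mul_le_mul_of_nonneg_left
            (Finset.sum_le_sum fun j _ => ?_) (sq_nonneg _)
          rw [← mul_pow]
          exact pow_le_pow_left₀ (norm_nonneg _) (P.le_opNorm _) 2
      _ = ‖matrixOp x‖ ^ 2 * (‖P‖ ^ 2 * ∑ j, ‖η j‖ ^ 2) := by
          rw [← Finset.mul_sum, Finset.sum_comm]
          simp only [PiLp.norm_sq_eq_of_L2, Finset.mul_sum]
      _ ≤ ‖matrixOp x‖ ^ 2 * (‖P‖ ^ 2 * ∑ j, ‖matrixOp y‖ ^ 2 * ∑ l, ‖β (j, l) • v‖ ^ 2) := by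
          refine mul_le_mul_of_nonneg_left (mul_le_mul_of_nonneg_left
            (Finset.sum_le_sum fun j _ => ?_) (sq_nonneg _)) (sq_nonneg _)
          exact norm_sq_matrixOp_apply_le y (WithLp.toLp 2 fun l => β (j, l) • v)
      _ = (‖matrixOp x‖ * ‖matrixOp y‖ * ‖P‖ * ‖β‖ * ‖v‖) ^ 2 := by
          rw [mul_pow, mul_pow, mul_pow, mul_pow, EuclideanSpace.norm_sq_eq,
            Fintype.sum_prod_type]
          simp only [norm_smul, mul_pow, ← Finset.sum_mul, ← Finset.mul_sum]
          ring
  rw [h1]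
  calc ‖∑ s, α s • matrixOp x (ζ s.2) s.1‖
      ≤ ∑ s, ‖α s‖ * ‖matrixOp x (ζ s.2) s.1‖ :=
        norm_sum_le_of_le _ fun s _ => (norm_smul _ _).le
    _ ≤ √(∑ s, ‖α s‖ ^ 2) * √(∑ s : ι × κ, ‖matrixOp x (ζ s.2) s.1‖ ^ 2) :=
        Real.sum_mul_le_sqrt_mul_sqrt _ _ _
    _ ≤ ‖α‖ * (‖matrixOp x‖ * ‖matrixOp y‖ * ‖P‖ * ‖β‖ * ‖v‖) := by
        rw [← EuclideanSpace.norm_eq]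
        exact mul_le_mul_of_nonneg_left (Real.sqrt_le_iff.2 ⟨by positivity, h2⟩) (norm_nonneg _)
    _ = _ := by ring

end Bounds

end OperatorAlgebra

end
noncomputable section

namespace OperatorAlgebra

variable {H : Type*} [NormedAddCommGroup H] [InnerProductSpace ℂ H]

/-! ### Approximating a diagonal by elements of the algebraic tensor product -/

section Approximation

variable {A : Subalgebra ℂ (H →L[ℂ] H)} (p : TensorSeminorm A)

namespace TensorSeminorm

theorem norm_leftActC_le (x : A) (z : p.Completed) : ‖p.leftActC x z‖ ≤ ‖x‖ * ‖z‖ := by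
  induction z using UniformSpace.Completion.induction_on with
  | hp => exact isClosed_le (by fun_prop) (by fun_prop)
  | ih w =>
    change ‖p.leftActC x (p.of (p.of.symm w) : p.Completed)‖ ≤ _
    rw [leftActC_coe, UniformSpace.Completion.norm_coe, UniformSpace.Completion.norm_coe]
    exact p.leftAct_le x _

theorem norm_rightActC_le (x : A) (z : p.Completed) : ‖p.rightActC x z‖ ≤ ‖x‖ * ‖z‖ := by
  induction z using UniformSpace.Completion.induction_on with
  | hp => exact isClosed_le (by fun_prop) (by fun_prop)
  | ih w =>
    change ‖p.rightActC x (p.of (p.of.symm w) : p.Completed)‖ ≤ _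
    rw [rightActC_coe, UniformSpace.Completion.norm_coe, UniformSpace.Completion.norm_coe]
    exact p.rightAct_le x _

theorem norm_prodMapC_le [CompleteSpace H] (z : p.Completed) : ‖p.prodMapC z‖ ≤ ‖z‖ := by
  induction z using UniformSpace.Completion.induction_on with
  | hp => exact isClosed_le (by fun_prop) (by fun_prop)
  | ih w =>
    change ‖p.prodMapC (p.of (p.of.symm w) : p.Completed)‖ ≤ _
    rw [prodMapC_coe, UniformSpace.Completion.norm_coe]
    exact p.prodMap_le _

theorem norm_coe_of (w : A ⊗[ℂ] A) : ‖(p.of w : p.Completed)‖ = p.toSeminorm w :=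
  UniformSpace.Completion.norm_coe _

theorem coe_of_sub (v w : A ⊗[ℂ] A) :
    (p.of (v - w) : p.Completed) = (p.of v : p.Completed) - (p.of w : p.Completed) :=
  UniformSpace.Completion.coe_sub (p.of v) (p.of w)

theorem exists_norm_sub_lt (u : p.Completed) {ε : ℝ} (hε : 0 < ε) :
    ∃ w : A ⊗[ℂ] A, ‖(p.of w : p.Completed) - u‖ < ε := by
  obtain ⟨w, hw⟩ := UniformSpace.Completion.denseRange_coe.exists_dist_lt u hε
  rw [dist_comm, dist_eq_norm] at hw
  exact ⟨p.of.symm w, hw⟩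

variable {p}

theorem IsDiagonal.norm_prodMap_sub_one_le [CompleteSpace H] {u : p.Completed}
    (hu : p.IsDiagonal u) (w : A ⊗[ℂ] A) :
    ‖prodMap A w - 1‖ ≤ ‖(p.of w : p.Completed) - u‖ := by
  have := p.norm_prodMapC_le ((p.of w : p.Completed) - u)
  rwa [map_sub, prodMapC_coe, hu.1] at this

/-- Since `x · u = u · x`, the commutator of `x` with `w` equals that with `w - u`, and each of the
two actions costs a factor `‖x‖`. -/
theorem IsDiagonal.seminorm_rightAct_sub_leftAct_le [CompleteSpace H] {u : p.Completed}
    (hu : p.IsDiagonal u) (x : A) (w : A ⊗[ℂ] A) :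
    p.toSeminorm (rightAct A x w - leftAct A x w) ≤
      2 * ‖(p.of w : p.Completed) - u‖ * ‖x‖ := by
  have h1 := p.norm_leftActC_le x ((p.of w : p.Completed) - u)
  have h2 := p.norm_rightActC_le x ((p.of w : p.Completed) - u)
  rw [← norm_coe_of, coe_of_sub, ← leftActC_coe, ← rightActC_coe]
  have h3 : p.rightActC x (p.of w : p.Completed) - p.leftActC x (p.of w : p.Completed) =
      p.rightActC x ((p.of w : p.Completed) - u) - p.leftActC x ((p.of w : p.Completed) - u) := by
    rw [map_sub, map_sub, hu.2 x]; abel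
  rw [h3]
  refine (norm_sub_le _ _).trans ?_
  linarith

end TensorSeminorm

end Approximation

/-! ### An algebra with a diagonal is finite dimensional -/

section FiniteDimensional

variable {A : Subalgebra ℂ (H →L[ℂ] H)} {p : TensorSeminorm A}

/-- The unit ball of `H` need not be compact, but a slice depends on `(e, η)` only through the
finitely many scalars `⟪η, a i e⟫`, which range over a bounded, hence totally bounded, subset of `ι
→ ℂ`. -/
theorem exists_finite_slice_net {ι : Type} [Fintype ι] (a b : ι → A) {δ : ℝ} (hδ : 0 < δ) :
    ∃ t : Set (H × H), t.Finite ∧ (∀ f ∈ t, ‖f.1‖ ≤ 1 ∧ ‖f.2‖ ≤ 1) ∧ ∀ e η : H, ‖e‖ ≤ 1 → ‖η‖ ≤ 1 → ∃ f ∈ t,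
      ‖slice A e η (∑ i, a i ⊗ₜ b i) - slice A f.1 f.2 (∑ i, a i ⊗ₜ b i)‖ ≤ δ := by
  let F : H × H → ι → ℂ := fun f i => inner ℂ f.2 ((a i : H →L[ℂ] H) f.1)
  let s : Set (H × H) := {f | ‖f.1‖ ≤ 1 ∧ ‖f.2‖ ≤ 1}
  have hb : Bornology.IsBounded (F '' s) := by
    refine isBounded_iff_forall_norm_le.2 ⟨∑ i, ‖a i‖, ?_⟩
    rintro _ ⟨f, ⟨h1, h2⟩, rfl⟩
    refine (pi_norm_le_iff_of_nonneg (by positivity)).2 fun i => ?_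
    refine (norm_inner_le_norm _ _).trans ?_
    have h3 := (a i : H →L[ℂ] H).le_opNorm f.1
    have h4 : ‖(a i : H →L[ℂ] H)‖ ≤ ∑ i, ‖a i‖ :=
      Finset.single_le_sum (f := fun i => ‖a i‖) (fun i _ => norm_nonneg _) (Finset.mem_univ i)
    have h5 := norm_nonneg (a i : H →L[ℂ] H)
    nlinarith [norm_nonneg f.1, norm_nonneg f.2, norm_nonneg ((a i : H →L[ℂ] H) f.1)]
  -- The summand `1` keeps the radius `δ / (∑ ‖b i‖ + 1)` meaningful when all `b i` vanish.
  have hM : 0 < ∑ i, ‖b i‖ + 1 := by positivity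
  -- The centres are chosen inside `F '' s`, so that they come from pairs in the unit balls.
  obtain ⟨t, hts, htf, hcov⟩ := Set.exists_subset_image_finite_and.1
    (Metric.finite_approx_of_totallyBounded
      (hb.isCompact_closure.totallyBounded.subset subset_closure) _ (div_pos hδ hM))
  refine ⟨t, htf, fun f hf => hts hf, fun e η he hη => ?_⟩
  have := hcov ⟨(e, η), ⟨he, hη⟩, rfl⟩
  simp only [Set.mem_iUnion, Set.mem_image, exists_prop, Metric.mem_ball] at this
  obtain ⟨_, ⟨f, hf, rfl⟩, hd⟩ := this
  refine ⟨f, hf, ?_⟩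
  rw [dist_eq_norm] at hd
  simp only [map_sum, slice_tmul, ← Finset.sum_sub_distrib, ← sub_smul]
  have h1 : ∀ i, ‖F (e, η) i - F f i‖ ≤ δ / (∑ i, ‖b i‖ + 1) := fun i =>
    (norm_le_pi_norm (F (e, η) - F f) i).trans hd.le
  calc _ ≤ ∑ i, δ / (∑ i, ‖b i‖ + 1) * ‖b i‖ := by
        refine norm_sum_le_of_le _ fun i _ => ?_
        rw [norm_smul]
        exact mul_le_mul_of_nonneg_right (h1 i) (norm_nonneg _)
    _ ≤ δ := by
        rw [← Finset.mul_sum, div_mul_eq_mul_div, div_le_iff₀ hM]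
        nlinarith

/-- The orthogonal projection onto the span of the `b i ξ` fixes each of these vectors, so inserting
it between `a i` and `b i` changes nothing at `ξ`. Its rank is at most the number of terms of the
representation. -/
theorem exists_projection_sandwich {ι : Type} [Fintype ι] (a b : ι → A) (ξ : H) :
    ∃ (n : ℕ) (e : Fin n → H), n ≤ Fintype.card ι ∧ (∀ k, ‖e k‖ = 1) ∧
      ‖∑ k, InnerProductSpace.rankOne ℂ (e k) (e k)‖ ≤ 1 ∧
      sandwich A (∑ k, InnerProductSpace.rankOne ℂ (e k) (e k)) (∑ i, a i ⊗ₜ b i) ξ =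
        prodMap A (∑ i, a i ⊗ₜ b i) ξ := by
  let S : Submodule ℂ H := Submodule.span ℂ (Set.range fun i => (b i : H →L[ℂ] H) ξ)
  have : FiniteDimensional ℂ S := FiniteDimensional.span_of_finite ℂ (Set.finite_range _)
  let o := stdOrthonormalBasis ℂ S
  have hP := o.starProjection_eq_sum_rankOne
  refine ⟨Module.finrank ℂ S, fun k => o k, finrank_range_le_card _, fun k => ?_, ?_, ?_⟩
  · exact (Submodule.coe_norm _).symm.trans (o.orthonormal.1 k)
  · rw [← hP]
    exact S.starProjection_norm_le
  · rw [← hP]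
    simp only [map_sum, sandwich_tmul, prodMap_tmul, sum_apply]
    refine Finset.sum_congr rfl fun i _ => ?_
    have : S.starProjection ((b i : H →L[ℂ] H) ξ) = (b i : H →L[ℂ] H) ξ :=
      Submodule.starProjection_eq_self_iff.2 (Submodule.subset_span ⟨i, rfl⟩)
    simp [this]

/-- Right multiplication by `x` passes inside the slice. At the net point `(e', η')` the slice of `w
· x` equals that of `w · x - x · w`, which is small because `w` is nearly a diagonal; moving from
`(e, η)` to the net point costs `δ ‖x‖`. -/
theorem SandwichBounded.norm_slice_mul_le [CompleteSpace H] (hp : SandwichBounded p)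
    {u : p.Completed} (hu : p.IsDiagonal u) (x : A) (w : A ⊗[ℂ] A) {e η e' η' : H} {δ : ℝ}
    (hδ : ‖slice A e η w - slice A e' η' w‖ ≤ δ) (hx : slice A e' η' (leftAct A x w) = 0) :
    ‖slice A e η w * x‖ ≤ (δ + 2 * ‖(p.of w : p.Completed) - u‖ * (‖e'‖ * ‖η'‖)) * ‖x‖ := by
  have h1 : slice A e η w * x = (slice A e η w - slice A e' η' w) * x +
      slice A e' η' (rightAct A x w - leftAct A x w) := by
    rw [LinearMap.map_sub, hx, slice_rightAct, sub_mul]; abel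
  rw [h1]
  have h2 := hp.norm_slice_le e' η' (rightAct A x w - leftAct A x w)
  have h3 := hu.seminorm_rightAct_sub_leftAct_le x w
  have h4 : ‖(slice A e η w - slice A e' η' w) * (x : H →L[ℂ] H)‖ ≤ δ * ‖x‖ :=
    (norm_mul_le _ _).trans (mul_le_mul_of_nonneg_right hδ (norm_nonneg _))
  refine (norm_add_le _ _).trans ((add_le_add h4 h2).trans ?_)
  have h5 := mul_le_mul_of_nonneg_right h3 (mul_nonneg (norm_nonneg e') (norm_nonneg η'))
  linarith

/-- Two approximants play different roles: `v = ∑ a i ⊗ b i` fixes the rank of the projection, while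
`w` supplies the small slices. With a single approximant, the number of terms could grow as the
error shrinks. The coefficient collects `d` from `prodMap A v ≈ 1`, `d + ε` from exchanging `v` for
`w`, and `δ + 2 * ε` for each rank-one piece. -/
theorem SandwichBounded.norm_le_of_slice_eq_zero [CompleteSpace H] (hp : SandwichBounded p)
    {u : p.Completed} (hu : p.IsDiagonal u) {ι : Type} [Fintype ι] (a b : ι → A) {w : A ⊗[ℂ] A}
    {ε δ : ℝ} (hε : ‖(p.of w : p.Completed) - u‖ ≤ ε)
    {t : Set (H × H)} (ht : ∀ f ∈ t, ‖f.1‖ ≤ 1 ∧ ‖f.2‖ ≤ 1)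
    (hnet : ∀ e η : H, ‖e‖ ≤ 1 → ‖η‖ ≤ 1 → ∃ f ∈ t,
      ‖slice A e η w - slice A f.1 f.2 w‖ ≤ δ) (hδ : 0 ≤ δ)
    (x : A) (hx : ∀ f ∈ t, slice A f.1 f.2 (leftAct A x w) = 0) :
    ‖x‖ ≤ (2 * ‖(p.of (∑ i, a i ⊗ₜ b i) : p.Completed) - u‖ + ε +
      Fintype.card ι * (δ + 2 * ε)) * ‖x‖ := by
  set v : A ⊗[ℂ] A := ∑ i, a i ⊗ₜ b i with hv
  set d : ℝ := ‖(p.of v : p.Completed) - u‖ with hd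
  have hε0 : 0 ≤ ε := (norm_nonneg _).trans hε
  refine ContinuousLinearMap.opNorm_le_bound (x : H →L[ℂ] H) (by positivity) fun ζ => ?_
  refine norm_le_of_norm_inner_le fun η hη => ?_
  set ξ : H := (x : H →L[ℂ] H) ζ with hξ
  have hξn : ‖ξ‖ ≤ ‖x‖ * ‖ζ‖ := (x : H →L[ℂ] H).le_opNorm ζ
  obtain ⟨n, e, hn, he, hP, hPv⟩ := exists_projection_sandwich a b ξ
  set P : H →L[ℂ] H := ∑ k, InnerProductSpace.rankOne ℂ (e k) (e k) with hPdef
  have hvw : p.toSeminorm (v - w) ≤ d + ε := by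
    rw [← p.norm_coe_of, p.coe_of_sub]
    exact (norm_sub_le_norm_sub_add_norm_sub _ u _).trans
      (add_le_add le_rfl (by rwa [norm_sub_rev]))
  have key : ∀ (T : H →L[ℂ] H) (M : ℝ), ‖T‖ ≤ M → ‖inner ℂ η (T ξ)‖ ≤ M * (‖x‖ * ‖ζ‖) := by
    intro T M hT
    have h0 : 0 ≤ M := (norm_nonneg _).trans hT
    calc ‖inner ℂ η (T ξ)‖ ≤ ‖η‖ * ‖T ξ‖ := norm_inner_le_norm _ _
      _ ≤ 1 * (M * (‖x‖ * ‖ζ‖)) := by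
        refine mul_le_mul hη ((T.le_opNorm ξ).trans (mul_le_mul hT hξn (norm_nonneg _) h0))
          (norm_nonneg _) zero_le_one
      _ = _ := one_mul _
  have h1 : ‖inner ℂ η ((prodMap A v - 1) ξ)‖ ≤ d * (‖x‖ * ‖ζ‖) :=
    key _ _ (hu.norm_prodMap_sub_one_le v)
  have h2 : ‖inner ℂ η (sandwich A P (v - w) ξ)‖ ≤ (d + ε) * (‖x‖ * ‖ζ‖) := by
    refine key _ _ ((hp P (v - w)).trans ?_)
    exact (mul_le_of_le_one_right (apply_nonneg p.toSeminorm _) hP).trans hvw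
  have h3 : ‖inner ℂ η (sandwich A P w ξ)‖ ≤ n * ((δ + 2 * ε) * (‖x‖ * ‖ζ‖)) := by
    rw [hPdef, sandwich_sum, sum_apply, inner_sum]
    refine (norm_sum_le_of_le _ (f := fun k => inner ℂ η
      (sandwich A (InnerProductSpace.rankOne ℂ (e k) (e k)) w ξ))
      (n := fun _ => (δ + 2 * ε) * (‖x‖ * ‖ζ‖)) fun k _ => ?_).trans_eq (by simp)
    -- Each rank-one term becomes `⟪e k, (slice A (e k) η w * x) ζ⟫`, since `ξ = x ζ`.
    rw [← inner_slice]
    obtain ⟨f, hf, hfδ⟩ := hnet (e k) η (he k).le hη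
    have h4 := hp.norm_slice_mul_le hu x w hfδ (hx f hf)
    have h5 : ‖f.1‖ * ‖f.2‖ ≤ 1 := mul_le_one₀ (ht f hf).1 (norm_nonneg _) (ht f hf).2
    have h6 : ‖(p.of w : p.Completed) - u‖ * (‖f.1‖ * ‖f.2‖) ≤ ε * 1 :=
      mul_le_mul hε h5 (by positivity) hε0
    calc _ ≤ ‖e k‖ * ‖(slice A (e k) η w * (x : H →L[ℂ] H)) ζ‖ := norm_inner_le_norm _ _
      _ ≤ 1 * (((δ + 2 * ε) * ‖x‖) * ‖ζ‖) := by
        rw [he k]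
        refine mul_le_mul_of_nonneg_left ((ContinuousLinearMap.le_opNorm _ ζ).trans
          (mul_le_mul_of_nonneg_right (h4.trans ?_) (norm_nonneg _))) zero_le_one
        exact mul_le_mul_of_nonneg_right (by linarith) (norm_nonneg _)
      _ = _ := by ring
  have h7 : inner ℂ η ξ = inner ℂ η (sandwich A P (v - w) ξ) + inner ℂ η (sandwich A P w ξ) -
      inner ℂ η ((prodMap A v - 1) ξ) := by
    have h : prodMap A v ξ = sandwich A P (v - w) ξ + sandwich A P w ξ := by
      rw [← hPv, (sandwich A P).map_sub v w, sub_apply, sub_add_cancel]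
    rw [sub_apply, h, ← inner_add_right, ← inner_sub_right, sub_sub_cancel]
    rfl
  rw [h7]
  refine (norm_sub_le _ _).trans ((add_le_add_left (norm_add_le _ _) _).trans ?_)
  have h8 : (n : ℝ) * ((δ + 2 * ε) * (‖x‖ * ‖ζ‖)) ≤
      Fintype.card ι * ((δ + 2 * ε) * (‖x‖ * ‖ζ‖)) :=
    mul_le_mul_of_nonneg_right (Nat.cast_le.2 hn) (by positivity)
  linarith

/-- Finitely many matrix coefficients, collected in `Λ`, determine an element of `A`. -/
theorem SandwichBounded.finiteDimensional [CompleteSpace H] (hp : SandwichBounded p)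
    {u : p.Completed} (hu : p.IsDiagonal u) : FiniteDimensional ℂ A := by
  obtain ⟨v, hv⟩ := p.exists_norm_sub_lt u (ε := 1 / 8) (by norm_num)
  obtain ⟨ι, _, a, b, rfl⟩ := exists_rep v
  set N : ℝ := ((Fintype.card ι : ℕ) : ℝ)
  have hN0 : 0 ≤ N := Nat.cast_nonneg _
  -- The accuracy is chosen after `N` is known, so that `N * (δ + 2 * ε) ≤ 3 / 16`. The total
  -- coefficient is then at most `2 / 8 + 1 / 16 + 3 / 16 = 1 / 2`.
  obtain ⟨w, hw⟩ := p.exists_norm_sub_lt u (ε := 1 / (16 * (N + 1))) (by positivity)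
  obtain ⟨κ, _, c, d, hcd⟩ := exists_rep w
  obtain ⟨t, htf, ht, hnet⟩ := exists_finite_slice_net c d (δ := 1 / (16 * (N + 1)))
    (by positivity)
  rw [← hcd] at hnet
  have := htf.fintype
  -- The coordinates of `Λ x` are `⟪f.2, x (c i) f.1⟫`, the coefficients of the `d i` in the net
  -- slices of `x · w`.
  let Λ : A →ₗ[ℂ] (t → κ → ℂ) := LinearMap.pi fun f => LinearMap.pi fun i =>
    (innerSL ℂ f.1.2).toLinearMap.comp ((ContinuousLinearMap.apply ℂ H f.1.1).toLinearMap.comp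
      (A.val.toLinearMap.comp (LinearMap.mulRight ℂ (c i))))
  refine Module.Finite.of_injective Λ ((injective_iff_map_eq_zero Λ).2 fun x hx => ?_)
  have hx' : ∀ f ∈ t, slice A f.1 f.2 (leftAct A x w) = 0 := by
    intro f hf
    rw [hcd]
    simp only [map_sum, leftAct_tmul, slice_tmul]
    refine Finset.sum_eq_zero fun i _ => ?_
    have : inner ℂ f.2 (((x * c i : A) : H →L[ℂ] H) f.1) = 0 :=
      congrFun (congrFun hx ⟨f, hf⟩) i
    rw [this, zero_smul]
  have h := hp.norm_le_of_slice_eq_zero hu a b hw.le ht hnet (by positivity) x hx'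
  have h1 : 1 / (16 * (N + 1)) ≤ 1 / 16 := by
    rw [div_le_div_iff₀ (by positivity) (by norm_num)]; linarith
  have h2 : N * (1 / (16 * (N + 1)) + 2 * (1 / (16 * (N + 1)))) ≤ 3 / 16 := by
    rw [show N * (1 / (16 * (N + 1)) + 2 * (1 / (16 * (N + 1)))) = 3 / 16 * (N / (N + 1)) by
      field_simp; ring]
    have : N / (N + 1) ≤ 1 := (div_le_one (by positivity)).2 (by linarith)
    linarith
  have h3 : ‖x‖ ≤ 1 / 2 * ‖x‖ := h.trans (mul_le_mul_of_nonneg_right (by linarith)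
    (norm_nonneg _))
  exact norm_le_zero_iff.1 (by linarith)

end FiniteDimensional

end OperatorAlgebra

end
noncomputable section

namespace OperatorAlgebra

variable {H : Type*} [NormedAddCommGroup H] [InnerProductSpace ℂ H]

/-! ### Diagonals of finite-dimensional algebras -/

section Separability

variable {A : Subalgebra ℂ (H →L[ℂ] H)} {p : TensorSeminorm A}

/-- All slices vanish by the slice bound, and slices separate the points of `A ⊗ A`: with `w = ∑ c i
⊗ B i` for a basis `B`, independence gives `⟪η, c i e⟫ = 0` for all `e` and `η`. -/
theorem SandwichBounded.eq_zero_of_seminorm_eq_zero (hp : SandwichBounded p) {w : A ⊗[ℂ] A}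
    (hw : p.toSeminorm w = 0) : w = 0 := by
  have hs : ∀ e η : H, slice A e η w = 0 := fun e η => by
    have := hp.norm_slice_le e η w
    rw [hw, zero_mul, zero_mul] at this
    exact norm_le_zero_iff.1 this
  let B := Module.Free.chooseBasis ℂ A
  obtain ⟨c, rfl⟩ := TensorProduct.eq_repr_basis_right B w
  have hc : c = 0 := by
    ext i : 1
    refine Subtype.ext (ContinuousLinearMap.ext fun e => ?_)
    refine ext_inner_left ℂ fun η => ?_
    have h := hs e η
    simp only [Finsupp.sum, map_sum, slice_tmul] at h
    have hB : LinearIndependent ℂ fun i => (B i : H →L[ℂ] H) :=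
      B.linearIndependent.map' A.val.toLinearMap
        (LinearMap.ker_eq_bot.2 Subtype.val_injective)
    have h' := linearIndependent_iff'.1 hB c.support _ h
    by_cases hi : i ∈ c.support
    · simpa using h' i hi
    · simp [Finsupp.notMem_support_iff.1 hi]
  rw [hc, Finsupp.sum_zero_index]

/-- The image of `A ⊗ A` in the completion is dense and finite dimensional, hence closed, so it
contains `u`. The identity `x · w = w · x` then descends to `A ⊗ A` because the seminorm is
definite. -/
theorem SandwichBounded.exists_algebraic_diagonal [CompleteSpace H] (hp : SandwichBounded p)
    [FiniteDimensional ℂ A] {u : p.Completed} (hu : p.IsDiagonal u) :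
    ∃ w : A ⊗[ℂ] A, prodMap A w = 1 ∧ ∀ x : A, leftAct A x w = rightAct A x w := by
  let L : p.Algebraic →L[ℂ] p.Completed := UniformSpace.Completion.toComplL
  let F : A ⊗[ℂ] A →ₗ[ℂ] p.Completed := L.toLinearMap ∘ₗ p.of.toLinearMap
  have hcl : IsClosed (F.range : Set p.Completed) := Submodule.closed_of_finiteDimensional _
  obtain ⟨w, rfl⟩ : ∃ w, F w = u := by
    change u ∈ (F.range : Set p.Completed)
    have hd : DenseRange ((↑) : p.Algebraic → p.Completed) :=
      UniformSpace.Completion.denseRange_coe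
    refine closure_minimal ?_ hcl (hd u)
    rintro _ ⟨v, rfl⟩
    exact ⟨p.of.symm v, rfl⟩
  change p.IsDiagonal (p.of w : p.Completed) at hu
  refine ⟨w, (p.prodMapC_coe w).symm.trans hu.1, fun x => ?_⟩
  let _ : AddGroup (A ⊗[ℂ] A) := (instAddCommGroupTensor A).toAddGroup
  refine sub_eq_zero.1 (hp.eq_zero_of_seminorm_eq_zero ?_)
  rw [← p.norm_coe_of, p.coe_of_sub, ← p.leftActC_coe, ← p.rightActC_coe, hu.2 x, sub_self,
    norm_zero]

end Separability

/-! ### Semisimplicity by averaging projections over an algebraic diagonal -/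

section Semisimple

variable {A : Subalgebra ℂ (H →L[ℂ] H)}

/-- The linear map `a ⊗ b ↦ a T (b x)`, for a fixed linear map `T : A → A`. -/
def average (T : A →ₗ[ℂ] A) (x : A) : A ⊗[ℂ] A →ₗ[ℂ] A :=
  LinearMap.mul' ℂ A ∘ₗ LinearMap.lTensor A (T ∘ₗ LinearMap.mulRight ℂ x)

@[simp] theorem average_tmul (T : A →ₗ[ℂ] A) (x a b : A) :
    average T x (a ⊗ₜ b) = a * T (b * x) := rfl

theorem average_add (T : A →ₗ[ℂ] A) (x y : A) (w : A ⊗[ℂ] A) :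
    average T (x + y) w = average T x w + average T y w := by
  induction w using TensorProduct.induction_on with
  | zero => simp
  | tmul a b => simp [mul_add]
  | add v w hv hw => rw [map_add, map_add, map_add, hv, hw]; abel

theorem average_leftAct (T : A →ₗ[ℂ] A) (x y : A) (w : A ⊗[ℂ] A) :
    average T x (leftAct A y w) = y * average T x w := by
  induction w using TensorProduct.induction_on with
  | zero => simp
  | tmul a b => simp [mul_assoc]
  | add v w hv hw => rw [map_add, map_add, map_add, hv, hw, mul_add]

theorem average_rightAct (T : A →ₗ[ℂ] A) (x y : A) (w : A ⊗[ℂ] A) :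
    average T x (rightAct A y w) = average T (y * x) w := by
  induction w using TensorProduct.induction_on with
  | zero => simp
  | tmul a b => simp [mul_assoc]
  | add v w hv hw => rw [map_add, map_add, map_add, hv, hw]

theorem average_mem (N : Submodule A A) {T : A →ₗ[ℂ] A} (hT : ∀ y, T y ∈ N) (x : A)
    (w : A ⊗[ℂ] A) : average T x w ∈ N := by
  induction w using TensorProduct.induction_on with
  | zero => simp
  | tmul a b => exact N.smul_mem a (hT _)
  | add v w hv hw => rw [map_add]; exact N.add_mem hv hw

theorem average_of_mem (N : Submodule A A) {T : A →ₗ[ℂ] A} (hT : ∀ y ∈ N, T y = y) {x : A}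
    (hx : x ∈ N) (w : A ⊗[ℂ] A) :
    (average T x w : H →L[ℂ] H) = prodMap A w * x := by
  induction w using TensorProduct.induction_on with
  | zero => simp
  | tmul a b =>
    have : T (b * x) = b * x := hT _ (N.smul_mem b hx)
    simp [this, mul_assoc]
  | add v w hv hw => rw [map_add, map_add, add_mul, ← hv, ← hw]; rfl

theorem exists_linear_projection {R : Type*} [Ring R] [Algebra ℂ R] (N : Submodule R R) :
    ∃ T : R →ₗ[ℂ] R, (∀ y, T y ∈ N) ∧ ∀ y ∈ N, T y = y := by
  obtain ⟨T, hT⟩ := (N.restrictScalars ℂ).subtype.exists_leftInverse_of_injective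
    (Submodule.ker_subtype _)
  exact ⟨(N.restrictScalars ℂ).subtype ∘ₗ T, fun y => (T y).2, fun y hy =>
    congrArg Subtype.val (LinearMap.congr_fun hT ⟨y, hy⟩)⟩

/-- As in Maschke's theorem, a `ℂ`-linear projection `T` onto a left ideal `N` is averaged to `x ↦ ∑
a i T (b i x)`. Commutation of `w` with `A` makes the average `A`-linear, and `∑ a i b i = 1` makes
it fix `N`; its kernel is the required complement. -/
theorem isSemisimpleRing_of_algebraic_diagonal {w : A ⊗[ℂ] A} (h1 : prodMap A w = 1)
    (h2 : ∀ x : A, leftAct A x w = rightAct A x w) : IsSemisimpleRing A := by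
  refine { exists_isCompl := fun N => ?_ }
  obtain ⟨T, hmem, hfix⟩ := exists_linear_projection N
  let E : A →ₗ[A] N :=
    { toFun := fun x => ⟨average T x w, average_mem N hmem x w⟩
      map_add' := fun x y => Subtype.ext (average_add T x y w)
      map_smul' := fun y x => Subtype.ext <| by
        change average T (y * x) w = y * average T x w
        -- The factor `y` enters as `w · y`, is exchanged for `y · w`, and leaves on the left.
        rw [← average_rightAct, ← h2, average_leftAct] }
  refine ⟨E.ker, LinearMap.isCompl_of_proj fun x => Subtype.ext (Subtype.ext ?_)⟩
  change (average T x w : H →L[ℂ] H) = _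
  rw [average_of_mem N hfix x.2, h1, one_mul]

end Semisimple

theorem SandwichBounded.exists_algEquiv_pi_matrix [CompleteSpace H]
    {A : Subalgebra ℂ (H →L[ℂ] H)} {p : TensorSeminorm A} (hp : SandwichBounded p)
    (h : ∃ u : p.Completed, p.IsDiagonal u) :
    ∃ (k : ℕ) (n : Fin k → ℕ), (∀ i, 0 < n i) ∧
      Nonempty (A ≃ₐ[ℂ] (∀ i : Fin k, Matrix (Fin (n i)) (Fin (n i)) ℂ)) := by
  obtain ⟨u, hu⟩ := h
  have := hp.finiteDimensional hu
  obtain ⟨w, h1, h2⟩ := hp.exists_algebraic_diagonal hu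
  have := isSemisimpleRing_of_algebraic_diagonal h1 h2
  obtain ⟨k, n, hn, he⟩ := IsSemisimpleRing.exists_algEquiv_pi_matrix_of_isAlgClosed ℂ A
  exact ⟨k, n, fun i => Nat.pos_of_ne_zero (hn i).out, he⟩

end OperatorAlgebra

end

/-- If a unital algebra `A` of operators on a complex Hilbert space `H` has a diagonal in the
Haagerup, the projective or the operator space projective tensor product of `A` with itself, then
`A` is isomorphic, as an algebra, to a finite direct sum of full matrix algebras. -/
theorem mainTheorem3 {H : Type*} [NormedAddCommGroup H] [InnerProductSpace ℂ H] [CompleteSpace H]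
    (A : Subalgebra ℂ (H →L[ℂ] H))
    (hA : (∃ u : (OperatorAlgebra.haagerup A).Completed,
        (OperatorAlgebra.haagerup A).IsDiagonal u) ∨
      (∃ u : (OperatorAlgebra.projective A).Completed,
        (OperatorAlgebra.projective A).IsDiagonal u) ∨
      (∃ u : (OperatorAlgebra.operatorProjective A).Completed,
        (OperatorAlgebra.operatorProjective A).IsDiagonal u)) :
    ∃ (k : ℕ) (n : Fin k → ℕ), (∀ i, 0 < n i) ∧
      Nonempty (A ≃ₐ[ℂ] (∀ i : Fin k, Matrix (Fin (n i)) (Fin (n i)) ℂ)) := by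
  rcases hA with h | h | h
  · exact OperatorAlgebra.sandwichBounded_haagerup.exists_algEquiv_pi_matrix h
  · exact OperatorAlgebra.sandwichBounded_projective.exists_algEquiv_pi_matrix h
  · exact OperatorAlgebra.sandwichBounded_operatorProjective.exists_algEquiv_pi_matrix h
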